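/- Let $N\ge 3$, $2^*=\frac{2N}{N-2}$, and let $\mathcal D^{1,2}=\mathcal D^{1,2}(\mathbb R^N)$ be the completion of $C_0^\infty(\mathbb R^N)$ in the norm $\|u\|=\left(\int|\nabla u|^2\right)^{1/2}$, regarded as a space of functions in $L^{2^*}(\mathbb R^N)$. Let $$S=\inf_{u\in\mathcal D^{1,2}\setminus\{0\}}\frac{\int|\nabla u|^2}{\left(\int|u|^{2^*}\right)^{2/2^*}},\qquad V\in L^{N/2}(\mathbb R^N)\ \text{ real-valued},\quad \|V\|_{L^{N/2}}<S,\qquad \|u\|_V^2=\int|\nabla u|^2+\int Vu^2 .$$ Let $f\in C^3(\mathbb R,\mathbb R)$ be even with $f(0)=f'(0)=f''(0)=0$ and assume: (a) there are $c_0,c_2>0$ and $2<p<2^*<q$ with $c_0|s|^p\le f(s)$ and $|f''(s)|\le c_2|s|^{p-2}$ for $|s|\ge1$, $c_0|s|^q<f(s)$ for $0<|s|\le1$, and $|f''(s)|\le c_2|s|^{q-2}$ for $|s|\le 1$; (b) there are $\mu_1>2$ and $\mu_2>1$ such that for all $s\ne0$: $0<\mu_1f(s)\le f'(s)s$, $\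 \mu_2f'(s)s<f''(s)s^2$ and $f'''(s)s^3>0$; (c) $f'''(u)u^3\in L^1(\mathbb R^N)$ for every $u\in\mathcal D^{1,2}$. For $g\in L^{\frac{2N}{N+2}}(\mathbb R^N)$ put $$\mathcal N_g^V=\Big\{u\in\mathcal D^{1,2}\setminus\{0\}:\ \|u\|_V^2-\int f'(u)u-\int gu=0\Big\},\qquad \mathcal V=\Big\{w\in\mathcal D^{1,2}\setminus\{0\}:\ \|w\|_V^2-\int f''(w)w^2=0\Big\}.$$ Then for every $u\in\mathcal D^{1,2}\setminus\{0\}$ there is exactly one $t_u^0>0$ with $t_u^0u\in\mathcal N_0^V$ and exactly one $T_u>0$ with $T_uu\in\mathcal V$. Moreover there is $\delta>0$, depending only on $N,V,f$, such that for all $g$ with $\|g\|_{L^{2N/(N+2)}}<\delta$ and all $u\in\mathcal D^{1,2}\setminus\{0\}$ (in particular for all $u$ with $\|u\|_V=1$): 1. if $\int gu<0$, there is exactly one $t_u^1>0$ with $t_u^1u\in\mathcal N_g^V$, and $t_u^0<t_u^1$; 2. if $\int gu=0$, there is exactly one $t_u^1>0$ with $t_u^1u\in\mathcal N_g^V$,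 and $t_u^1=t_u^0$; 3. if $\int gu>0$, there are exactly two positive numbers $t_u^1,t_u^2$ with $t_u^ju\in\mathcal N_g^V$, and $t_u^2<T_u<t_u^1<t_u^0$; 4. $t_u^1=t^1_u(g)$ is a $C^1$ function of $(u,g)$ on $\{(u,g)\in\mathcal D^{1,2}\times L^{\frac{2N}{N+2}}:u\neq0,\ \|g\|_{L^{2N/(N+2)}}<\delta\}$, and $t_u^2=t_u^2(g)$ is a $C^1$ function of $(u,g)$ on the subset of this set where $\int gu>0$. Furthermore, for each fixed $u\ne0$, $t_u^1(g)\to t_u^0$ as $\|g\|_{L^{2N/(N+2)}}\to0$. -/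

import Mathlib

open MeasureTheory Set Filter Topology
open scoped ENNReal NNReal ContDiff

noncomputable section

namespace NehariFiber

/-- The space `ℝ^N` with its Euclidean norm and Lebesgue measure `volume`. -/
abbrev RN (N : ℕ) : Type := EuclideanSpace ℝ (Fin N)

/-- The critical Sobolev exponent `2^* = 2N/(N-2)`. -/
def critExp (N : ℕ) : ℝ := 2 * (N : ℝ) / ((N : ℝ) - 2)

/-- The exponent `2N/(N+2)`, conjugate to `2^*`. -/
def dualExp (N : ℕ) : ℝ := 2 * (N : ℝ) / ((N : ℝ) + 2)

theorem three_le_cast (N : ℕ) [hN : Fact (3 ≤ N)] : (3 : ℝ) ≤ N := by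
  exact_mod_cast hN.out

theorem one_le_critExp (N : ℕ) [Fact (3 ≤ N)] : 1 ≤ critExp N := by
  have h := three_le_cast N
  unfold critExp
  rw [le_div_iff₀ (by linarith)]
  linarith

theorem one_le_dualExp (N : ℕ) [Fact (3 ≤ N)] : 1 ≤ dualExp N := by
  have h := three_le_cast N
  unfold dualExp
  rw [le_div_iff₀ (by linarith)]
  linarith

instance critExp_fact (N : ℕ) [Fact (3 ≤ N)] : Fact (1 ≤ ENNReal.ofReal (critExp N)) :=
  ⟨by simpa using ENNReal.ofReal_le_ofReal (one_le_critExp N)⟩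

instance dualExp_fact (N : ℕ) [Fact (3 ≤ N)] : Fact (1 ≤ ENNReal.ofReal (dualExp N)) :=
  ⟨by simpa using ENNReal.ofReal_le_ofReal (one_le_dualExp N)⟩

/-- `L^{2^*}(ℝ^N)`. -/
abbrev LCrit (N : ℕ) : Type := Lp ℝ (ENNReal.ofReal (critExp N)) (volume : Measure (RN N))

/-- `L^{2N/(N+2)}(ℝ^N)`. -/
abbrev LDual (N : ℕ) : Type := Lp ℝ (ENNReal.ofReal (dualExp N)) (volume : Measure (RN N))

/-- `L^2(ℝ^N; ℝ^N)`, the space of gradients. -/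
abbrev LGrad (N : ℕ) : Type := Lp (RN N) 2 (volume : Measure (RN N))

theorem gradient_add_of_smooth {N : ℕ} {φ ψ : RN N → ℝ} (hφ : ContDiff ℝ ∞ φ)
    (hψ : ContDiff ℝ ∞ ψ) : gradient (φ + ψ) = gradient φ + gradient ψ := by
  funext x
  have h1 : DifferentiableAt ℝ φ x := (hφ.differentiable (by simp)) x
  have h2 : DifferentiableAt ℝ ψ x := (hψ.differentiable (by simp)) x
  simp [gradient, fderiv_add h1 h2]

theorem gradient_smul_of_smooth {N : ℕ} (c : ℝ) {φ : RN N → ℝ} (hφ : ContDiff ℝ ∞ φ) :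
    gradient (c • φ) = c • gradient φ := by
  funext x
  have h1 : DifferentiableAt ℝ φ x := (hφ.differentiable (by simp)) x
  simp [gradient, fderiv_const_smul h1]

/-- The space of all pairs `(φ, ∇φ)`, `φ ∈ C_0^∞(ℝ^N)`, in `L^{2^*} × L^2`. -/
def testPairs (N : ℕ) [Fact (3 ≤ N)] : Submodule ℝ (LCrit N × LGrad N) where
  carrier := {w | ∃ φ : RN N → ℝ, ContDiff ℝ ∞ φ ∧ HasCompactSupport φ ∧
    w.1 =ᵐ[volume] φ ∧ w.2 =ᵐ[volume] gradient φ}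
  zero_mem' := by
    refine ⟨0, contDiff_const, HasCompactSupport.zero, Lp.coeFn_zero _ _ _, ?_⟩
    have h : gradient (0 : RN N → ℝ) = 0 := by
      funext x
      simp [gradient]
    rw [h]
    exact Lp.coeFn_zero _ _ _
  add_mem' := by
    rintro a b ⟨φ, h1, h2, h3, h4⟩ ⟨ψ, k1, k2, k3, k4⟩
    refine ⟨φ + ψ, h1.add k1, h2.add k2, (Lp.coeFn_add _ _).trans (h3.add k3), ?_⟩
    rw [gradient_add_of_smooth h1 k1]
    exact (Lp.coeFn_add _ _).trans (h4.add k4)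
  smul_mem' := by
    rintro c a ⟨φ, h1, h2, h3, h4⟩
    refine ⟨c • φ, contDiff_const.smul h1, h2.smul_left,
      (Lp.coeFn_smul _ _).trans (h3.const_smul c), ?_⟩
    rw [gradient_smul_of_smooth c h1]
    exact (Lp.coeFn_smul _ _).trans (h4.const_smul c)

/-- The closure of `{(φ, ∇φ) : φ ∈ C_0^∞}` in `L^{2^*} × L^2`. -/
def pairs (N : ℕ) [Fact (3 ≤ N)] : Submodule ℝ (LCrit N × LGrad N) :=
  (testPairs N).topologicalClosure

/-- The Sobolev inequality on the closure. -/
theorem sobolev_pairs (N : ℕ) [Fact (3 ≤ N)] :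
    ∃ C : ℝ, ∀ w ∈ pairs N, ‖w.1‖ ≤ C * ‖w.2‖ := by
  have hN := three_le_cast N
  refine ⟨(SNormLESNormFDerivOfEqConst ℝ (volume : Measure (RN N)) 2 : ℝ≥0), fun w hw => ?_⟩
  have hcl : IsClosed {w : LCrit N × LGrad N | ‖w.1‖ ≤
      ((SNormLESNormFDerivOfEqConst ℝ (volume : Measure (RN N)) 2 : ℝ≥0) : ℝ) * ‖w.2‖} :=
    isClosed_le (by fun_prop) (by fun_prop)
  refine closure_minimal ?_ hcl hw
  rintro a ⟨φ, h1, h2, h3, h4⟩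
  have hcr : 0 ≤ critExp N := zero_le_one.trans (one_le_critExp N)
  have key := eLpNorm_le_eLpNorm_fderiv_of_eq (volume : Measure (RN N)) (u := φ)
    (h1.of_le (by simp)) h2 (p := 2) (p' := (critExp N).toNNReal) (by norm_num)
    (by rw [finrank_euclideanSpace, Fintype.card_fin]; have := (Fact.out : 3 ≤ N); omega) (by
      rw [Real.coe_toNNReal _ hcr]
      simp only [finrank_euclideanSpace, Fintype.card_fin, critExp]
      have : (N : ℝ) - 2 ≠ 0 := by linarith
      have : (N : ℝ) ≠ 0 := by linarith
      push_cast
      field_simp)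
  have hg : eLpNorm (fderiv ℝ φ) 2 (volume : Measure (RN N)) = eLpNorm a.2 2 volume := by
    rw [eLpNorm_congr_ae h4]
    refine eLpNorm_congr_norm_ae (Eventually.of_forall fun x => ?_)
    simp [gradient]
  have ha : eLpNorm φ ((critExp N).toNNReal : ℝ≥0∞) (volume : Measure (RN N))
      = eLpNorm a.1 (ENNReal.ofReal (critExp N)) volume := (eLpNorm_congr_ae h3).symm
  rw [show ((2 : ℝ≥0) : ℝ≥0∞) = 2 by norm_num, hg, ha] at key
  simp only [mem_ofPred_eq, Lp.norm_def]
  have h5 := ENNReal.toReal_mono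
    (ENNReal.mul_ne_top ENNReal.coe_ne_top (Lp.eLpNorm_ne_top a.2)) key
  simpa [ENNReal.toReal_mul] using h5

/-- `𝒟^{1,2}(ℝ^N)`, the completion of `C_0^∞(ℝ^N)` for the norm `(∫ |∇u|^2)^{1/2}`, realised as
a space of functions in `L^{2^*}`: an element is a function `u ∈ L^{2^*}` together with its (weak)
gradient, a limit in `L^{2^*} × L^2` of pairs `(φ, ∇φ)` with `φ ∈ C_0^∞`.  The norm of the space
is the norm of the gradient in `L^2` (see the instance below); by the Sobolev inequality it is
equivalent to the norm of `L^{2^*} × L^2` on these pairs. -/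
def D12 (N : ℕ) [Fact (3 ≤ N)] : Type := pairs N

namespace D12

variable {N : ℕ} [Fact (3 ≤ N)]

instance : AddCommGroup (D12 N) := inferInstanceAs (AddCommGroup (pairs N))

instance : Module ℝ (D12 N) := inferInstanceAs (Module ℝ (pairs N))

/-- The function `u ∈ L^{2^*}` underlying an element of `𝒟^{1,2}`. -/
def fn : D12 N →ₗ[ℝ] LCrit N := (LinearMap.fst ℝ (LCrit N) (LGrad N)) ∘ₗ (pairs N).subtype

/-- The gradient `∇u ∈ L^2` of an element of `𝒟^{1,2}`. -/
def grad : D12 N →ₗ[ℝ] LGrad N := (LinearMap.snd ℝ (LCrit N) (LGrad N)) ∘ₗ (pairs N).subtype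

theorem grad_injective : Function.Injective (grad : D12 N → LGrad N) := by
  rw [← LinearMap.ker_eq_bot, LinearMap.ker_eq_bot']
  intro w hw
  obtain ⟨C, hC⟩ := sobolev_pairs N
  have h2 : (w.1 : LCrit N × LGrad N).2 = 0 := hw
  have h := hC w.1 w.2
  rw [h2, norm_zero, mul_zero] at h
  have h1 : (w.1 : LCrit N × LGrad N).1 = 0 := norm_le_zero_iff.mp h
  exact Subtype.ext (Prod.ext h1 h2)

/-- The norm of `𝒟^{1,2}` is `‖u‖ = ‖∇u‖_{L^2}`. -/
instance : NormedAddCommGroup (D12 N) :=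
  NormedAddCommGroup.induced (D12 N) (LGrad N) grad grad_injective

instance : NormedSpace ℝ (D12 N) := NormedSpace.induced ℝ (D12 N) (LGrad N) grad

end D12

/-- The best Sobolev constant
`S = inf { ∫ |∇u|^2 / (∫ |u|^{2^*})^{2/2^*} : u ∈ 𝒟^{1,2}, u ≠ 0 }`. -/
def sobolevConst (N : ℕ) [Fact (3 ≤ N)] : ℝ :=
  ⨅ u : {u : D12 N // u ≠ 0},
    (∫ x, ‖D12.grad u.1 x‖ ^ 2) / (∫ x, |D12.fn u.1 x| ^ critExp N) ^ (2 / critExp N)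

/-- `‖u‖_V^2 = ∫ |∇u|^2 + ∫ V u^2`. -/
def normSqV {N : ℕ} [Fact (3 ≤ N)] (V : RN N → ℝ) (u : D12 N) : ℝ :=
  (∫ x, ‖D12.grad u x‖ ^ 2) + ∫ x, V x * D12.fn u x ^ 2

/-- The pairing `∫ g u`. -/
def pairing {N : ℕ} [Fact (3 ≤ N)] (g : LDual N) (u : D12 N) : ℝ :=
  ∫ x, g x * D12.fn u x

/-- The Nehari manifold
`𝒩_g^V = { u ∈ 𝒟^{1,2} \ {0} : ∫ |∇u|^2 + ∫ V u^2 - ∫ f'(u) u - ∫ g u = 0 }`. -/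
def nehari {N : ℕ} [Fact (3 ≤ N)] (V : RN N → ℝ) (f : ℝ → ℝ) (g : LDual N) : Set (D12 N) :=
  {u | u ≠ 0 ∧
    normSqV V u - (∫ x, deriv f (D12.fn u x) * D12.fn u x) - pairing g u = 0}

/-- The set `𝒱 = { w ≠ 0 : ‖w‖_V^2 - ∫ f''(w) w^2 = 0 }`. -/
def inflection {N : ℕ} [Fact (3 ≤ N)] (V : RN N → ℝ) (f : ℝ → ℝ) : Set (D12 N) :=
  {w | w ≠ 0 ∧
    normSqV V w - (∫ x, iteratedDeriv 2 f (D12.fn w x) * D12.fn w x ^ 2) = 0}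

/-- The class of double power nonlinearities `f` on `ℝ^N`. -/
structure IsDoublePower (N : ℕ) [Fact (3 ≤ N)] (f : ℝ → ℝ) : Prop where
  even : ∀ s, f (-s) = f s
  contDiff : ContDiff ℝ 3 f
  zero : f 0 = 0
  deriv_zero : deriv f 0 = 0
  deriv2_zero : iteratedDeriv 2 f 0 = 0
  growth : ∃ c₀ c₂ p q : ℝ, 0 < c₀ ∧ 0 < c₂ ∧ 2 < p ∧ p < critExp N ∧ critExp N < q ∧
    (∀ s, 1 ≤ |s| → c₀ * |s| ^ p ≤ f s) ∧
    (∀ s, s ≠ 0 → |s| ≤ 1 → c₀ * |s| ^ q < f s) ∧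
    (∀ s, 1 ≤ |s| → |iteratedDeriv 2 f s| ≤ c₂ * |s| ^ (p - 2)) ∧
    (∀ s, |s| ≤ 1 → |iteratedDeriv 2 f s| ≤ c₂ * |s| ^ (q - 2))
  superquadratic : ∃ μ₁ μ₂ : ℝ, 2 < μ₁ ∧ 1 < μ₂ ∧ ∀ s, s ≠ 0 →
    0 < μ₁ * f s ∧ μ₁ * f s ≤ deriv f s * s ∧
    μ₂ * (deriv f s * s) < iteratedDeriv 2 f s * s ^ 2 ∧
    0 < iteratedDeriv 3 f s * s ^ 3
  integrable_deriv3 : ∀ u : D12 N,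
    Integrable (fun x => iteratedDeriv 3 f (D12.fn u x) * D12.fn u x ^ 3)

end NehariFiber

end

/-!
Fix `u ≠ 0` and put `A = ‖u‖_V^2`, `H(t) = ∫ f'(t u) u`.  For `t > 0` the point `t u` lies in
`𝒩_g^V` exactly when `m(t) = t A - H(t)` takes the value `∫ g u`, and in `𝒱` exactly when
`m'(t) = A - ∫ f''(t u) u ^ 2` vanishes.  Since `‖V‖_{N/2} < S`, the form `‖·‖_V^2` is coercive, so
`A > 0` (`exists_normSqV_ge`).  Since `f''` is even and strictly increasing on `[0, ∞)` from `0` to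
`∞`, `m` is strictly concave with `m(0) = 0`, `m'(0) = A` and `m(t) → -∞` (`isConcaveFibre`).  Hence
`m` increases on `[0, T_u]` and decreases on `[T_u, ∞)`: a level below the maximum is attained once
on the descending branch, and in addition once on the ascending branch if it is positive
(`IsConcaveFibre.existsUnique_descending`, `IsConcaveFibre.existsUnique_ascending`).  The growth
bound `|f''(s)| ≤ C |s| ^ (2^* - 2)` gives `max m ≥ c ‖u‖` with `c` independent of `u`, whereas
`∫ g u ≤ C ‖g‖ ‖u‖`; so for small `‖g‖` the level is always below the maximum
(`exists_pairing_lt_max`).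

For the regularity, `((u, g), t) ↦ ‖t u‖_V^2 - ∫ f'(t u) t u - ∫ g t u` is of class `C^1`.  The
nonlinear term is treated by `contDiff_integral_comp`, which rests on the continuity of the
superposition operator from `L^p` to `L^q` (`continuous_superposition`).  At a zero with `t > 0` the
`t`-derivative is `t m'(t)`, which is nonzero away from `T_u`, and its sign tells the two branches
apart; so the implicit function theorem, applied in the complete space `𝒟^{1,2} × L^{2N/(N+2)}`,
shows that each branch is `C^1` (`contDiffOn_branch`).
-/

namespace NehariFiber

/-! ### Integral functionals on `L^p` -/

/-- A function with a line derivative in every direction which is given by a continuous linear map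
depending continuously on the base point is `C^1`. -/
theorem contDiff_one_of_hasLineDerivAt {E F : Type*} [NormedAddCommGroup E] [NormedSpace ℝ E]
    [NormedAddCommGroup F] [NormedSpace ℝ F] {Ψ : E → F} {L : E → E →L[ℝ] F}
    (hΨ : ∀ u h, HasLineDerivAt ℝ Ψ (L u h) u h) (hL : Continuous L) : ContDiff ℝ 1 Ψ := by
  refine contDiff_one_iff_hasFDerivAt.2 ⟨L, hL, fun u => ?_⟩
  rw [hasFDerivAt_iff_isLittleO_nhds_zero, Asymptotics.isLittleO_iff]
  intro ε hε
  obtain ⟨δ, hδ, hball⟩ := Metric.continuousAt_iff.1 (hL.continuousAt (x := u)) ε hε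
  filter_upwards [Metric.ball_mem_nhds (0 : E) hδ] with h hh
  rw [mem_ball_zero_iff] at hh
  have hline : ∀ θ : ℝ, HasDerivAt (fun θ : ℝ => Ψ (u + θ • h) - θ • L u h)
      (L (u + θ • h) h - L u h) θ := fun θ => by
    have h1 : HasDerivAt (fun s : ℝ => Ψ (u + θ • h + s • h)) (L (u + θ • h) h) (θ - θ) := by
      rw [sub_self]
      exact hΨ (u + θ • h) h
    have h2 := HasDerivAt.scomp (h := fun s : ℝ => s - θ) θ h1 ((hasDerivAt_id θ).sub_const θ)
    have h3 : HasDerivAt (fun s : ℝ => Ψ (u + s • h)) (L (u + θ • h) h) θ := by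
      convert h2 using 1
      · funext s
        simp [add_assoc, ← add_smul]
      · simp
    exact (h3.sub ((hasDerivAt_id θ).smul_const (L u h))).congr_deriv (by simp)
  have hmvt := norm_image_sub_le_of_norm_deriv_le_segment_01' (C := ε * ‖h‖)
    (fun θ _ => (hline θ).hasDerivWithinAt) (fun θ hθ => by
      rw [← _root_.sub_apply]
      refine (ContinuousLinearMap.le_opNorm _ _).trans ?_
      gcongr
      have hd : dist (u + θ • h) u < δ := by
        rw [dist_eq_norm, add_sub_cancel_left, norm_smul, Real.norm_of_nonneg hθ.1]
        exact (mul_le_of_le_one_left (norm_nonneg h) hθ.2.le).trans_lt hh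
      rw [← dist_eq_norm]
      exact (hball hd).le)
  simpa [sub_sub, add_comm] using hmvt

theorem rpow_abs_add_le {p : ℝ} (hp : 0 ≤ p) (a b : ℝ) :
    |a + b| ^ p ≤ 2 ^ p * (|a| ^ p + |b| ^ p) := by
  have h1 : |a + b| ≤ 2 * max |a| |b| := by
    have := abs_add_le a b
    have := le_max_left |a| |b|
    have := le_max_right |a| |b|
    linarith
  have h2 : max |a| |b| ^ p ≤ |a| ^ p + |b| ^ p := by
    have := Real.rpow_nonneg (abs_nonneg a) p
    have := Real.rpow_nonneg (abs_nonneg b) p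
    rcases max_choice |a| |b| with h | h <;> rw [h] <;> linarith
  calc |a + b| ^ p ≤ (2 * max |a| |b|) ^ p := Real.rpow_le_rpow (abs_nonneg _) h1 hp
    _ = 2 ^ p * max |a| |b| ^ p :=
      Real.mul_rpow (by norm_num) (le_max_of_le_left (abs_nonneg a))
    _ ≤ _ := by gcongr

section Superposition

variable {α : Type*} [MeasurableSpace α] {μ : Measure α} {p q : ℝ} {k : ℝ → ℝ} {C : ℝ}

theorem Lp.integrable_abs_rpow (hp : 0 < p) (u : Lp ℝ (ENNReal.ofReal p) μ) :
    Integrable (fun x => |u x| ^ p) μ := by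
  simpa [ENNReal.toReal_ofReal hp.le] using
    (Lp.memLp u).integrable_norm_rpow (by simpa using hp) ENNReal.ofReal_ne_top

theorem Lp.norm_rpow_eq_integral (hp : 0 < p) (u : Lp ℝ (ENNReal.ofReal p) μ) :
    ‖u‖ ^ p = ∫ x, |u x| ^ p ∂μ := by
  have h0 : 0 ≤ ∫ x, |u x| ^ p ∂μ :=
    integral_nonneg fun x => Real.rpow_nonneg (abs_nonneg _) _
  rw [Lp.norm_def, (Lp.memLp u).eLpNorm_eq_integral_rpow_norm (by simpa using hp)
    ENNReal.ofReal_ne_top, ENNReal.toReal_ofReal hp.le,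
    ENNReal.toReal_ofReal (Real.rpow_nonneg (by simpa using h0) _)]
  simp only [Real.norm_eq_abs]
  rw [← Real.rpow_mul h0, inv_mul_cancel₀ hp.ne', Real.rpow_one]

theorem memLp_comp_of_rpow_le (hp : 0 < p) (hq : 0 < q) (hk : Continuous k)
    (hC : ∀ s, |k s| ^ q ≤ C * |s| ^ p) (u : Lp ℝ (ENNReal.ofReal p) μ) :
    MemLp (fun x => k (u x)) (ENNReal.ofReal q) μ := by
  have hm : AEStronglyMeasurable (fun x => k (u x)) μ :=
    hk.comp_aestronglyMeasurable (Lp.aestronglyMeasurable u)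
  rw [← integrable_norm_rpow_iff hm (by simpa using hq) ENNReal.ofReal_ne_top,
    ENNReal.toReal_ofReal hq.le]
  refine ((Lp.integrable_abs_rpow hp u).const_mul C).mono'
    ((hk.norm.rpow_const fun _ => Or.inr hq.le).comp_aestronglyMeasurable
      (Lp.aestronglyMeasurable u)) (Eventually.of_forall fun x => ?_)
  rw [Real.norm_of_nonneg (Real.rpow_nonneg (norm_nonneg _) _)]
  exact hC (u x)

/-- A continuous `k` with `|k s| ^ q ≤ C |s| ^ p` acts continuously by composition from `L^p` to
`L^q`.  Along a subsequence `u_n → u` almost everywhere, and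
`|k(u_n) - k(u)|^q ≤ D |u_n - u|^p + D |u|^p`; the part of the left side exceeding
`D |u_n - u|^p` is dominated by the fixed integrable function `D |u|^p`. -/
theorem continuous_superposition (hp : 1 ≤ p) (hq : 1 ≤ q) [Fact (1 ≤ ENNReal.ofReal p)]
    [Fact (1 ≤ ENNReal.ofReal q)] (hk : Continuous k) (hC0 : 0 ≤ C)
    (hC : ∀ s, |k s| ^ q ≤ C * |s| ^ p) :
    Continuous fun u : Lp ℝ (ENNReal.ofReal p) μ =>
      (memLp_comp_of_rpow_le (by linarith) (by linarith) hk hC u).toLp := by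
  have hp0 : 0 < p := by linarith
  have hq0 : 0 < q := by linarith
  set K : Lp ℝ (ENNReal.ofReal p) μ → Lp ℝ (ENNReal.ofReal q) μ := fun u =>
      (memLp_comp_of_rpow_le hp0 hq0 hk hC u).toLp
  refine continuous_iff_seqContinuous.2 fun w u hw => ?_
  refine tendsto_of_subseq_tendsto fun ns hns => ?_
  have hw1 : Tendsto (fun n => w (ns n)) atTop (𝓝 u) := hw.comp hns
  obtain ⟨ms, hms, hae⟩ := (tendstoInMeasure_of_tendsto_Lp hw1).exists_seq_tendsto_ae
  refine ⟨ms, ?_⟩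
  set v : ℕ → Lp ℝ (ENNReal.ofReal p) μ := fun n => w (ns (ms n))
  have hv1 : Tendsto v atTop (𝓝 u) := hw1.comp hms.tendsto_atTop
  set D : ℝ := 2 ^ q * C * 2 ^ p with hD
  set D' : ℝ := 2 ^ q * C * (2 ^ p + 1) with hD'
  have hD0 : 0 ≤ D := by positivity
  have hpt : ∀ a b : ℝ, |k a - k b| ^ q ≤ D * |a - b| ^ p + D' * |b| ^ p := fun a b => by
    have h1 := rpow_abs_add_le hq0.le (k a) (-k b)
    have h2 := rpow_abs_add_le hp0.le (a - b) b
    rw [sub_add_cancel] at h2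
    rw [abs_neg, ← sub_eq_add_neg] at h1
    calc |k a - k b| ^ q ≤ 2 ^ q * (C * (2 ^ p * (|a - b| ^ p + |b| ^ p)) + C * |b| ^ p) := by
          refine h1.trans ?_
          gcongr
          · exact (hC a).trans (by gcongr)
          · exact hC b
      _ = _ := by rw [hD, hD']; ring
  have hdist : ∀ n, ‖K (v n) - K u‖ ^ q = ∫ x, |k (v n x) - k (u x)| ^ q ∂μ := fun n => by
    rw [Lp.norm_rpow_eq_integral hq0]
    refine integral_congr_ae ?_
    filter_upwards [Lp.coeFn_sub (K (v n)) (K u),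
      (memLp_comp_of_rpow_le hp0 hq0 hk hC (v n)).coeFn_toLp,
      (memLp_comp_of_rpow_le hp0 hq0 hk hC u).coeFn_toLp] with x h1 h2 h3
    rw [h1, Pi.sub_apply, h2, h3]
  have hdistp : ∀ n, ‖v n - u‖ ^ p = ∫ x, |v n x - u x| ^ p ∂μ := fun n => by
    rw [Lp.norm_rpow_eq_integral hp0]
    refine integral_congr_ae ?_
    filter_upwards [Lp.coeFn_sub (v n) u] with x h1
    rw [h1, Pi.sub_apply]
  have hintp : ∀ n, Integrable (fun x => |v n x - u x| ^ p) μ := fun n => by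
    refine (Lp.integrable_abs_rpow hp0 (v n - u)).congr ?_
    filter_upwards [Lp.coeFn_sub (v n) u] with x h1
    rw [h1, Pi.sub_apply]
  have hmeas : ∀ n, AEStronglyMeasurable (fun x => |k (v n x) - k (u x)| ^ q) μ := fun n =>
    ((Real.continuous_rpow_const hq0.le).comp continuous_abs).comp_aestronglyMeasurable
      ((hk.comp_aestronglyMeasurable (Lp.aestronglyMeasurable _)).sub
        (hk.comp_aestronglyMeasurable (Lp.aestronglyMeasurable _)))
  -- the excess over `D |v n - u| ^ p`, to which dominated convergence applies
  set e : ℕ → α → ℝ := fun n x =>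
    max (|k (v n x) - k (u x)| ^ q - D * |v n x - u x| ^ p) 0 with he
  have hemeas : ∀ n, AEStronglyMeasurable (e n) μ := fun n =>
    ((hmeas n).sub ((hintp n).1.const_mul D)).sup aestronglyMeasurable_const
  have hebd : ∀ n, ∀ᵐ x ∂μ, ‖e n x‖ ≤ D' * |u x| ^ p := fun n => Eventually.of_forall fun x => by
    rw [Real.norm_of_nonneg (le_max_right _ _)]
    refine max_le ?_ (by positivity)
    linarith [hpt (v n x) (u x)]
  have hint : Integrable (fun x => D' * |u x| ^ p) μ := (Lp.integrable_abs_rpow hp0 u).const_mul _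
  have helim : Tendsto (fun n => ∫ x, e n x ∂μ) atTop (𝓝 0) := by
    have := tendsto_integral_of_dominated_convergence (f := fun _ : α => (0 : ℝ)) _ hemeas hint hebd
      (by
        filter_upwards [hae] with x hx
        have h1 : Tendsto (fun n => k (v n x)) atTop (𝓝 (k (u x))) := (hk.tendsto _).comp hx
        have h2 : Tendsto (fun n => |k (v n x) - k (u x)| ^ q) atTop (𝓝 0) := by
          have := ((h1.sub_const (k (u x))).abs).rpow_const (p := q) (Or.inr hq0.le)
          simpa [Real.zero_rpow hq0.ne'] using this
        have h3 : Tendsto (fun n => D * |v n x - u x| ^ p) atTop (𝓝 0) := by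
          have := (((Tendsto.sub_const hx (u x)).abs).rpow_const (p := p)
            (Or.inr hp0.le)).const_mul D
          simpa [Real.zero_rpow hp0.ne'] using this
        have := (h2.sub h3).max (tendsto_const_nhds (x := (0 : ℝ)))
        simpa [he] using this)
    simpa using this
  have hle : ∀ n, ‖K (v n) - K u‖ ^ q ≤ (∫ x, e n x ∂μ) + D * ‖v n - u‖ ^ p := fun n => by
    rw [hdist, hdistp, ← integral_const_mul, ← integral_add (hint.mono' (hemeas n) (hebd n))
      ((hintp n).const_mul D)]
    refine integral_mono_of_nonneg (Eventually.of_forall fun x => by positivity)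
      ((hint.mono' (hemeas n) (hebd n)).add ((hintp n).const_mul D))
      (Eventually.of_forall fun x => ?_)
    have := le_max_left (|k (v n x) - k (u x)| ^ q - D * |v n x - u x| ^ p) 0
    simp only [he]
    linarith
  have hsq : Tendsto (fun n => ‖K (v n) - K u‖ ^ q) atTop (𝓝 0) := by
    refine squeeze_zero (fun n => by positivity) hle ?_
    have h1 : Tendsto (fun n => ‖v n - u‖) atTop (𝓝 0) :=
      tendsto_iff_norm_sub_tendsto_zero.1 hv1
    have h2 := (h1.rpow_const (p := p) (Or.inr hp0.le)).const_mul D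
    rw [Real.zero_rpow hp0.ne', mul_zero] at h2
    simpa using helim.add h2
  have hroot := hsq.rpow_const (p := q⁻¹) (Or.inr (by positivity))
  rw [Real.zero_rpow (by positivity)] at hroot
  refine tendsto_iff_norm_sub_tendsto_zero.2 (hroot.congr fun n => ?_)
  rw [← Real.rpow_mul (norm_nonneg _), mul_inv_cancel₀ hq0.ne', Real.rpow_one]
  rfl

end Superposition

theorem abs_le_rpow_of_deriv_le {k k' : ℝ → ℝ} {C a : ℝ} (ha : 0 ≤ a)
    (hk : ∀ s, HasDerivAt k (k' s) s) (hk0 : k 0 = 0) (hC : ∀ s, |k' s| ≤ C * |s| ^ a) (s : ℝ) :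
    |k s| ≤ C * |s| ^ (a + 1) := by
  have hC0 : 0 ≤ C := by simpa using (abs_nonneg _).trans (hC 1)
  have := (convex_closedBall (0 : ℝ) |s|).norm_image_sub_le_of_norm_hasDerivWithin_le
    (f := k) (f' := k') (C := C * |s| ^ a) (x := 0) (y := s)
    (fun x _ => (hk x).hasDerivWithinAt) (fun x hx => (hC x).trans (by
      rw [mem_closedBall_zero_iff] at hx
      exact mul_le_mul_of_nonneg_left (Real.rpow_le_rpow (abs_nonneg _) hx ha) hC0))
    (by simp) (by simp)
  rw [hk0, sub_zero, sub_zero, Real.norm_eq_abs, Real.norm_eq_abs] at this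
  rw [Real.rpow_add_one' (abs_nonneg s) (by linarith), ← mul_assoc]
  exact this

/-- If `k 0 = 0` and `|k' s| ≤ C |s| ^ (p - 1)` with `k'` continuous, then `u ↦ ∫ k(u)` is `C^1`
on `L^p`; its derivative at `u` is the pairing with `k'(u)`, an element of the dual `L^q`. -/
theorem contDiff_integral_comp {α : Type*} [MeasurableSpace α] {μ : Measure α} {p : ℝ}
    (hp : 1 < p) [Fact (1 ≤ ENNReal.ofReal p)] {k k' : ℝ → ℝ} {C : ℝ}
    (hk : ∀ s, HasDerivAt k (k' s) s) (hk' : Continuous k') (hk0 : k 0 = 0)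
    (hC : ∀ s, |k' s| ≤ C * |s| ^ (p - 1)) :
    ContDiff ℝ 1 fun u : Lp ℝ (ENNReal.ofReal p) μ => ∫ x, k (u x) ∂μ := by
  have hp0 : 0 < p := by linarith
  have hC0 : 0 ≤ C := by simpa using (abs_nonneg _).trans (hC 1)
  have hconj : p.HolderConjugate (Real.conjExponent p) := Real.HolderConjugate.conjExponent hp
  set q := Real.conjExponent p with hq
  have hq1 : 1 < q := hconj.symm.lt
  have hmul : (p - 1) * q = p := by rw [hconj.sub_one_mul_conj]
  have : Fact (1 ≤ ENNReal.ofReal q) := ⟨by simpa using hq1.le⟩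
  have : (ENNReal.ofReal q).HolderConjugate (ENNReal.ofReal p) := hconj.symm.ennrealOfReal
  have hk'q : ∀ s, |k' s| ^ q ≤ C ^ q * |s| ^ p := fun s => by
    refine (Real.rpow_le_rpow (abs_nonneg _) (hC s) (by linarith)).trans_eq ?_
    rw [Real.mul_rpow hC0 (by positivity), ← Real.rpow_mul (abs_nonneg s), hmul]
  have hkp : ∀ s, |k s| ≤ C * |s| ^ p := fun s => by
    simpa using abs_le_rpow_of_deriv_le (by linarith) hk hk0 hC s
  have hkc : Continuous k := continuous_iff_continuousAt.2 fun s => (hk s).continuousAt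
  have hkm := memLp_comp_of_rpow_le (μ := μ) hp0 (by linarith) hk' hk'q
  have hcont := continuous_superposition (μ := μ) hp.le hq1.le hk' (by positivity) hk'q
  refine contDiff_one_of_hasLineDerivAt
    (L := fun u => (ContinuousLinearMap.mul ℝ ℝ).lpPairing μ (ENNReal.ofReal q) (ENNReal.ofReal p)
      (hkm u).toLp) (fun u h => ?_) ((ContinuousLinearMap.continuous _).comp hcont)
  have hL : (ContinuousLinearMap.mul ℝ ℝ).lpPairing μ (ENNReal.ofReal q) (ENNReal.ofReal p)
      (hkm u).toLp h = ∫ x, k' (u x + 0 * h x) * h x ∂μ := by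
    rw [ContinuousLinearMap.lpPairing_eq_integral]
    refine integral_congr_ae ?_
    filter_upwards [(hkm u).coeFn_toLp] with x hx
    simp [hx]
  rw [HasLineDerivAt]
  have hfun : (fun t : ℝ => ∫ x, k ((u + t • h : Lp ℝ (ENNReal.ofReal p) μ) x) ∂μ)
      = fun t : ℝ => ∫ x, k (u x + t * h x) ∂μ := by
    funext t
    refine integral_congr_ae ?_
    filter_upwards [Lp.coeFn_add u (t • h), Lp.coeFn_smul t h] with x h1 h2
    rw [h1, Pi.add_apply, h2, Pi.smul_apply, smul_eq_mul]
  rw [hL, hfun]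
  have hum := Lp.aestronglyMeasurable u
  have hhm := Lp.aestronglyMeasurable h
  have hbound : Integrable (fun x => C * (2 ^ p * (|u x| ^ p + |h x| ^ p) + |h x| ^ p)) μ :=
    (((((Lp.integrable_abs_rpow hp0 u).add (Lp.integrable_abs_rpow hp0 h)).const_mul _)).add
      (Lp.integrable_abs_rpow hp0 h)).const_mul C
  refine (hasDerivAt_integral_of_dominated_loc_of_deriv_le (F := fun t x => k (u x + t * h x))
    (F' := fun t x => k' (u x + t * h x) * h x) (Metric.ball_mem_nhds (0 : ℝ) one_pos)
    (Eventually.of_forall fun t => hkc.comp_aestronglyMeasurable (hum.add (hhm.const_mul t)))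
    ?_ ((hk'.comp_aestronglyMeasurable (hum.add (hhm.const_mul 0))).mul hhm)
    (Eventually.of_forall fun x t ht => ?_) hbound
    (Eventually.of_forall fun x t _ => ?_)).2
  · simp only [zero_mul, add_zero]
    exact ((Lp.integrable_abs_rpow hp0 u).const_mul C).mono' (hkc.comp_aestronglyMeasurable hum)
      (Eventually.of_forall fun x => hkp _)
  · rw [mem_ball_zero_iff, Real.norm_eq_abs] at ht
    set M := |u x| + |h x| with hM
    have h1 : |u x + t * h x| ≤ M := by
      refine (abs_add_le _ _).trans ?_
      rw [abs_mul, hM]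
      gcongr
      exact mul_le_of_le_one_left (abs_nonneg _) ht.le
    have hM0 : 0 ≤ M := by positivity
    have h2 : M ^ p ≤ 2 ^ p * (|u x| ^ p + |h x| ^ p) := by
      have := rpow_abs_add_le hp0.le |u x| |h x|
      rwa [abs_abs, abs_abs, abs_of_nonneg hM0] at this
    rw [norm_mul, Real.norm_eq_abs, Real.norm_eq_abs]
    calc |k' (u x + t * h x)| * |h x| ≤ (C * M ^ (p - 1)) * M := by
          gcongr
          · exact (hC _).trans (by gcongr)
          · rw [hM]; linarith [abs_nonneg (u x)]
      _ = C * M ^ p := by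
          rw [mul_assoc, ← Real.rpow_add_one' hM0 (by linarith), sub_add_cancel]
      _ ≤ _ := by
          gcongr
          have : 0 ≤ |h x| ^ p := by positivity
          linarith
  · exact ((hk (u x + t * h x)).comp (h := fun s : ℝ => u x + s * h x) t
      (((hasDerivAt_id t).mul_const (h x)).const_add (u x))).congr_deriv (by simp)

/-! ### The nonlinearity -/

/-- The properties of `f₁ = f'` and `f₂ = f''` used below: `f''` is even, strictly increasing on
`[0, ∞)` from `0` to `∞`, and of growth at most `|s| ^ (r - 2)`, where `r` is the critical
exponent. -/
structure IsConvexPower (r : ℝ) (f₁ f₂ : ℝ → ℝ) : Prop where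
  hasDerivAt : ∀ s, HasDerivAt f₁ (f₂ s) s
  continuous₂ : Continuous f₂
  zero₁ : f₁ 0 = 0
  zero₂ : f₂ 0 = 0
  even₂ : ∀ s, f₂ (-s) = f₂ s
  strictMonoOn : StrictMonoOn f₂ (Ici 0)
  tendsto_atTop : Tendsto f₂ atTop atTop
  growth : ∃ C, 0 ≤ C ∧ ∀ s, |f₂ s| ≤ C * |s| ^ (r - 2)

theorem two_lt_critExp (N : ℕ) [Fact (3 ≤ N)] : 2 < critExp N := by
  have h := three_le_cast N
  unfold critExp
  rw [lt_div_iff₀ (by linarith)]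
  linarith

theorem IsDoublePower.isConvexPower {N : ℕ} [Fact (3 ≤ N)] {f : ℝ → ℝ} (hf : IsDoublePower N f) :
    IsConvexPower (critExp N) (deriv f) (iteratedDeriv 2 f) := by
  have h12 : iteratedDeriv 2 f = deriv (deriv f) := by
    rw [iteratedDeriv_succ, iteratedDeriv_one]
  have hd1 : ContDiff ℝ 2 (deriv f) :=
    ((contDiff_succ_iff_deriv (n := 2) (f := f)).1 (by norm_num; exact hf.contDiff)).2.2
  have hd2 : ContDiff ℝ 1 (iteratedDeriv 2 f) := by
    rw [h12]
    exact ((contDiff_succ_iff_deriv (n := 1)).1 (by norm_num; exact hd1)).2.2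
  obtain ⟨c₀, c₂, p, q, hc₀, hc₂, hp, hpr, hrq, hf1, hf2, hf3, hf4⟩ := hf.growth
  obtain ⟨μ₁, μ₂, hμ₁, hμ₂, hsup⟩ := hf.superquadratic
  refine ⟨fun s => ?_, hd2.continuous, hf.deriv_zero, hf.deriv2_zero, fun s => ?_, ?_, ?_,
    c₂, hc₂.le, fun s => ?_⟩
  · rw [h12]
    exact ((hd1.differentiable (by norm_num)) s).hasDerivAt
  · have h := iteratedDeriv_comp_neg 2 f s
    rw [show (fun x => f (-x)) = f from funext hf.even] at h
    simpa using h.symm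
  · refine strictMonoOn_of_deriv_pos (convex_Ici 0) hd2.continuous.continuousOn fun s hs => ?_
    rw [interior_Ici] at hs
    -- `f''' > 0` on `(0, ∞)`, as `f'''(s) s ^ 3 > 0`
    have h := (hsup s (ne_of_gt hs)).2.2.2
    rw [← iteratedDeriv_succ]
    exact pos_of_mul_pos_left h (pow_pos hs 3).le
  · -- `f''(s) s ^ 2 ≥ f'(s) s ≥ 2 f(s) ≥ 2 c₀ s ^ p` for `s ≥ 1`
    have h1 : Tendsto (fun s : ℝ => 2 * c₀ * s ^ (p - 2)) atTop atTop :=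
      (tendsto_rpow_atTop (by linarith)).const_mul_atTop (by positivity)
    refine tendsto_atTop_mono' _ ?_ h1
    filter_upwards [eventually_ge_atTop (1 : ℝ)] with s hs
    have hs0 : 0 < s := by linarith
    obtain ⟨k1, k2, k3, -⟩ := hsup s hs0.ne'
    have k4 := hf1 s (by rwa [abs_of_pos hs0])
    rw [abs_of_pos hs0] at k4
    have k5 : 0 < f s := pos_of_mul_pos_right k1 (by linarith)
    have k6 : s ^ p = s ^ (p - 2) * s ^ 2 := by
      rw [← Real.rpow_natCast, ← Real.rpow_add hs0]
      norm_num
    have k7 : 2 * c₀ * s ^ (p - 2) * s ^ 2 ≤ iteratedDeriv 2 f s * s ^ 2 := by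
      rw [mul_assoc, mul_assoc, ← k6]
      nlinarith
    exact le_of_mul_le_mul_right k7 (by positivity)
  · rcases le_total 1 |s| with h | h
    · exact (hf3 s h).trans (mul_le_mul_of_nonneg_left
        (Real.rpow_le_rpow_of_exponent_le h (by linarith)) hc₂.le)
    · refine (hf4 s h).trans (mul_le_mul_of_nonneg_left ?_ hc₂.le)
      exact Real.rpow_le_rpow_of_exponent_ge_of_imp (abs_nonneg s) h (by linarith)
        (fun _ h0 => absurd h0 (by have := two_lt_critExp N; linarith))

namespace IsConvexPower

variable {r : ℝ} {f₁ f₂ : ℝ → ℝ}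

theorem abs_eq (hf : IsConvexPower r f₁ f₂) (s : ℝ) : f₂ |s| = f₂ s := by
  rcases abs_choice s with h | h <;> rw [h]
  exact hf.even₂ s

theorem nonneg₂ (hf : IsConvexPower r f₁ f₂) (s : ℝ) : 0 ≤ f₂ s := by
  rw [← hf.abs_eq, ← hf.zero₂]
  exact hf.strictMonoOn.monotoneOn self_mem_Ici (abs_nonneg s) (abs_nonneg s)

theorem mono_abs (hf : IsConvexPower r f₁ f₂) {a b : ℝ} (h : |a| ≤ |b|) : f₂ a ≤ f₂ b := by
  rw [← hf.abs_eq a, ← hf.abs_eq b]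
  exact hf.strictMonoOn.monotoneOn (abs_nonneg a) (abs_nonneg b) h

theorem strictMono_abs (hf : IsConvexPower r f₁ f₂) {a b : ℝ} (h : |a| < |b|) : f₂ a < f₂ b := by
  rw [← hf.abs_eq a, ← hf.abs_eq b]
  exact hf.strictMonoOn (abs_nonneg a) (abs_nonneg b) h

theorem continuous₁ (hf : IsConvexPower r f₁ f₂) : Continuous f₁ :=
  continuous_iff_continuousAt.2 fun s => (hf.hasDerivAt s).continuousAt

theorem growth₁ (hf : IsConvexPower r f₁ f₂) (hr : 2 < r) {C : ℝ}
    (hC : ∀ s, |f₂ s| ≤ C * |s| ^ (r - 2)) (s : ℝ) : |f₁ s| ≤ C * |s| ^ (r - 1) := by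
  have := abs_le_rpow_of_deriv_le (by linarith) hf.hasDerivAt hf.zero₁ hC s
  rwa [show r - 2 + 1 = r - 1 by ring] at this

/-- `u ↦ ∫ f'(u) u` is of class `C^1` on `L^r`. -/
theorem contDiff_integral (hf : IsConvexPower r f₁ f₂) (hr : 2 < r) {α : Type*}
    [MeasurableSpace α] {μ : Measure α} [Fact (1 ≤ ENNReal.ofReal r)] :
    ContDiff ℝ 1 fun u : Lp ℝ (ENNReal.ofReal r) μ => ∫ x, f₁ (u x) * u x ∂μ := by
  obtain ⟨C, hC0, hC⟩ := hf.growth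
  refine contDiff_integral_comp (k := fun s => f₁ s * s) (k' := fun s => f₂ s * s + f₁ s)
    (C := 2 * C) (by linarith)
    (fun s => ((hf.hasDerivAt s).mul (hasDerivAt_id s)).congr_deriv (by simp))
    ((hf.continuous₂.mul continuous_id).add hf.continuous₁) (by simp) fun s => ?_
  have h1 : |s| ^ (r - 1) = |s| ^ (r - 2) * |s| := by
    rw [← Real.rpow_add_one' (abs_nonneg s) (by linarith)]
    congr 1
    ring
  calc |f₂ s * s + f₁ s| ≤ |f₂ s| * |s| + |f₁ s| := by
        rw [← abs_mul]
        exact abs_add_le _ _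
    _ ≤ C * |s| ^ (r - 2) * |s| + C * |s| ^ (r - 1) := by
        gcongr
        · exact hC s
        · exact hf.growth₁ hr hC s
    _ = _ := by rw [h1]; ring

end IsConvexPower

/-! ### The fibre integrals -/

section Fibre

variable {α : Type*} [MeasurableSpace α] {μ : Measure α} {r : ℝ} {f₁ f₂ : ℝ → ℝ}

/-- The fibre integral `t ↦ ∫ f₁(t u) u`. -/
noncomputable def fibre (μ : Measure α) (f₁ : ℝ → ℝ) (u : α → ℝ) (t : ℝ) : ℝ := ∫ x, f₁ (t * u x) * u x ∂μ

/-- The derivative `t ↦ ∫ f₂(t u) u ^ 2` of the fibre integral, where `f₂ = f₁'`. -/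
noncomputable def fibreDeriv (μ : Measure α) (f₂ : ℝ → ℝ) (u : α → ℝ) (t : ℝ) : ℝ :=
  ∫ x, f₂ (t * u x) * u x ^ 2 ∂μ

theorem abs_rpow_eq_mul_sq (hr : 2 < r) (a : ℝ) : |a| ^ r = |a| ^ (r - 2) * a ^ 2 := by
  rw [← sq_abs, ← Real.rpow_natCast, ← Real.rpow_add' (abs_nonneg a) (by push_cast; linarith)]
  norm_num

theorem abs_mul_sq_le {C : ℝ} (hr : 2 < r) (hC : ∀ s, |f₂ s| ≤ C * |s| ^ (r - 2)) (t a : ℝ) :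
    |f₂ (t * a) * a ^ 2| ≤ C * |t| ^ (r - 2) * |a| ^ r := by
  rw [abs_mul, abs_of_nonneg (sq_nonneg a), abs_rpow_eq_mul_sq hr, ← mul_assoc, mul_assoc C,
    ← Real.mul_rpow (abs_nonneg t) (abs_nonneg a), ← abs_mul]
  exact mul_le_mul_of_nonneg_right (hC _) (sq_nonneg a)

theorem abs_mul_le {C : ℝ} (hr : 2 < r) (hC : ∀ s, |f₁ s| ≤ C * |s| ^ (r - 1)) (t a : ℝ) :
    |f₁ (t * a) * a| ≤ C * |t| ^ (r - 1) * |a| ^ r := by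
  have h : |a| ^ r = |a| ^ (r - 1) * |a| := by
    rw [← Real.rpow_add_one' (abs_nonneg a) (by linarith), sub_add_cancel]
  rw [abs_mul, h, ← mul_assoc, mul_assoc C,
    ← Real.mul_rpow (abs_nonneg t) (abs_nonneg a), ← abs_mul t a]
  exact mul_le_mul_of_nonneg_right (hC _) (abs_nonneg a)

namespace IsConvexPower

theorem integrable_fibreDeriv (hf : IsConvexPower r f₁ f₂) (hr : 2 < r)
    (u : Lp ℝ (ENNReal.ofReal r) μ) (t : ℝ) :
    Integrable (fun x => f₂ (t * u x) * u x ^ 2) μ := by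
  obtain ⟨C, hC0, hC⟩ := hf.growth
  exact ((Lp.integrable_abs_rpow (by linarith) u).const_mul _).mono'
    ((hf.continuous₂.comp_aestronglyMeasurable ((Lp.aestronglyMeasurable u).const_mul t)).mul
      ((Lp.aestronglyMeasurable u).pow 2))
    (Eventually.of_forall fun x => abs_mul_sq_le hr hC t (u x))

theorem integrable_fibre (hf : IsConvexPower r f₁ f₂) (hr : 2 < r)
    (u : Lp ℝ (ENNReal.ofReal r) μ) (t : ℝ) : Integrable (fun x => f₁ (t * u x) * u x) μ := by
  obtain ⟨C, hC0, hC⟩ := hf.growth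
  exact ((Lp.integrable_abs_rpow (by linarith) u).const_mul _).mono'
    ((hf.continuous₁.comp_aestronglyMeasurable ((Lp.aestronglyMeasurable u).const_mul t)).mul
      (Lp.aestronglyMeasurable u))
    (Eventually.of_forall fun x => abs_mul_le hr (hf.growth₁ hr hC) t (u x))

theorem abs_fibre_le (hf : IsConvexPower r f₁ f₂) (hr : 2 < r) :
    ∃ C, 0 ≤ C ∧ ∀ (u : Lp ℝ (ENNReal.ofReal r) μ) (t : ℝ),
      |fibre μ f₁ u t| ≤ C * |t| ^ (r - 1) * ‖u‖ ^ r := by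
  obtain ⟨C, hC0, hC⟩ := hf.growth
  refine ⟨C, hC0, fun u t => ?_⟩
  rw [Lp.norm_rpow_eq_integral (by linarith), ← integral_const_mul]
  refine (abs_integral_le_integral_abs (f := fun x => f₁ (t * u x) * u x)).trans ?_
  exact integral_mono (hf.integrable_fibre hr u t).abs
    ((Lp.integrable_abs_rpow (by linarith) u).const_mul _)
    fun x => abs_mul_le hr (hf.growth₁ hr hC) t (u x)

theorem hasDerivAt_fibre (hf : IsConvexPower r f₁ f₂) (hr : 2 < r)
    (u : Lp ℝ (ENNReal.ofReal r) μ) (t : ℝ) :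
    HasDerivAt (fibre μ f₁ u) (fibreDeriv μ f₂ u t) t := by
  obtain ⟨C, hC0, hC⟩ := hf.growth
  refine (hasDerivAt_integral_of_dominated_loc_of_deriv_le (F := fun s x => f₁ (s * u x) * u x)
    (F' := fun s x => f₂ (s * u x) * u x ^ 2)
    (bound := fun x => C * (|t| + 1) ^ (r - 2) * |u x| ^ r)
    (Metric.ball_mem_nhds t one_pos) (Eventually.of_forall fun s => (hf.integrable_fibre hr u s).1)
    (hf.integrable_fibre hr u t) (hf.integrable_fibreDeriv hr u t).1
    (Eventually.of_forall fun x s hs => ?_)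
    ((Lp.integrable_abs_rpow (by linarith) u).const_mul _)
    (Eventually.of_forall fun x s _ => ?_)).2
  · refine (abs_mul_sq_le hr hC s (u x)).trans ?_
    rw [Metric.mem_ball, Real.dist_eq] at hs
    have : |s| ≤ |t| + 1 := by linarith [abs_sub_abs_le_abs_sub s t]
    have : 0 ≤ r - 2 := by linarith
    gcongr
  · exact (((hf.hasDerivAt (s * u x)).comp (h := fun s : ℝ => s * u x) s
      ((hasDerivAt_id s).mul_const (u x))).mul_const (u x)).congr_deriv (by simp; ring)

theorem continuous_fibreDeriv (hf : IsConvexPower r f₁ f₂) (hr : 2 < r)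
    (u : Lp ℝ (ENNReal.ofReal r) μ) : Continuous (fibreDeriv μ f₂ u) := by
  obtain ⟨C, hC0, hC⟩ := hf.growth
  refine continuous_iff_continuousAt.2 fun t => ?_
  refine continuousAt_of_dominated (bound := fun x => C * (|t| + 1) ^ (r - 2) * |u x| ^ r)
    (Eventually.of_forall fun s => (hf.integrable_fibreDeriv hr u s).1) ?_
    ((Lp.integrable_abs_rpow (by linarith) u).const_mul _)
    (Eventually.of_forall fun x => by
      have := hf.continuous₂
      fun_prop)
  filter_upwards [Metric.ball_mem_nhds t one_pos] with s hs
  refine Eventually.of_forall fun x => (abs_mul_sq_le hr hC s (u x)).trans ?_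
  rw [Metric.mem_ball, Real.dist_eq] at hs
  have : |s| ≤ |t| + 1 := by linarith [abs_sub_abs_le_abs_sub s t]
  have : 0 ≤ r - 2 := by linarith
  gcongr

theorem strictMonoOn_fibreDeriv (hf : IsConvexPower r f₁ f₂) (hr : 2 < r)
    {u : Lp ℝ (ENNReal.ofReal r) μ} (hu : u ≠ 0) : StrictMonoOn (fibreDeriv μ f₂ u) (Ici 0) := by
  intro s hs t ht hst
  have hle : ∀ x, f₂ (s * u x) * u x ^ 2 ≤ f₂ (t * u x) * u x ^ 2 := fun x => by
    refine mul_le_mul_of_nonneg_right (hf.mono_abs ?_) (sq_nonneg _)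
    rw [abs_mul, abs_mul, abs_of_nonneg (mem_Ici.1 hs), abs_of_nonneg (mem_Ici.1 ht)]
    gcongr
  refine lt_of_le_of_ne (integral_mono (hf.integrable_fibreDeriv hr u s)
    (hf.integrable_fibreDeriv hr u t) hle) fun heq => hu ?_
  have h := (integral_eq_iff_of_ae_le (hf.integrable_fibreDeriv hr u s)
    (hf.integrable_fibreDeriv hr u t) (Eventually.of_forall hle)).1 heq
  refine (Lp.eq_zero_iff_ae_eq_zero).2 ?_
  filter_upwards [h] with x hx
  by_contra h0
  have h0' : u x ≠ 0 := h0
  have h1 : f₂ (s * u x) < f₂ (t * u x) := by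
    refine hf.strictMono_abs ?_
    rw [abs_mul, abs_mul, abs_of_nonneg (mem_Ici.1 hs), abs_of_nonneg (mem_Ici.1 ht)]
    exact mul_lt_mul_of_pos_right hst (abs_pos.2 h0')
  exact (mul_lt_mul_of_pos_right h1 (by positivity : 0 < u x ^ 2)).ne hx

/-- `∫ f''(t u) u ^ 2 → ∞`: the integral is at least `f''(t ε) ε ^ 2 |{|u| ≥ ε}|`. -/
theorem tendsto_fibreDeriv (hf : IsConvexPower r f₁ f₂) (hr : 2 < r)
    {u : Lp ℝ (ENNReal.ofReal r) μ} (hu : u ≠ 0) : Tendsto (fibreDeriv μ f₂ u) atTop atTop := by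
  obtain ⟨n, hn⟩ : ∃ n : ℕ, μ {x | 1 / ((n : ℝ) + 1) ≤ ‖u x‖} ≠ 0 := by
    by_contra! h
    refine hu ((Lp.eq_zero_iff_ae_eq_zero).2 ?_)
    have h1 := measure_iUnion_null h
    rw [Filter.EventuallyEq, ae_iff]
    refine measure_mono_null (fun x hx => ?_) h1
    obtain ⟨n, hn⟩ := exists_nat_one_div_lt (norm_pos_iff.2 (show u x ≠ 0 from hx))
    exact mem_iUnion.2 ⟨n, hn.le⟩
  set ε : ℝ := 1 / ((n : ℝ) + 1) with hε
  have hε0 : 0 < ε := by positivity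
  set S := {x | ε ≤ ‖u x‖} with hS
  have hfin : μ S < ⊤ := by
    have h1 := (Lp.integrable_abs_rpow (by linarith) u).measure_norm_ge_lt_top
      (Real.rpow_pos_of_pos hε0 r)
    refine (measure_mono fun x hx => ?_).trans_lt h1
    have hx' : ε ≤ |u x| := hx
    change ε ^ r ≤ ‖|u x| ^ r‖
    rw [Real.norm_of_nonneg (by positivity)]
    exact Real.rpow_le_rpow hε0.le hx' (by linarith)
  have hSm : NullMeasurableSet S μ :=
    nullMeasurableSet_le aemeasurable_const (Lp.aestronglyMeasurable u).norm.aemeasurable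
  have hpos : 0 < μ.real S := ENNReal.toReal_pos hn hfin.ne
  have hlow : Tendsto (fun t : ℝ => f₂ (t * ε) * (ε ^ 2 * μ.real S)) atTop atTop :=
    (hf.tendsto_atTop.comp (tendsto_id.atTop_mul_const hε0)).atTop_mul_const (by positivity)
  refine tendsto_atTop_mono' _ ?_ hlow
  filter_upwards [eventually_ge_atTop (0 : ℝ)] with t ht
  have hint := hf.integrable_fibreDeriv hr u t
  calc f₂ (t * ε) * (ε ^ 2 * μ.real S) = ∫ _ in S, f₂ (t * ε) * ε ^ 2 ∂μ := by
        rw [setIntegral_const, smul_eq_mul]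
        ring
    _ ≤ ∫ x in S, f₂ (t * u x) * u x ^ 2 ∂μ := by
        refine setIntegral_mono_on₀ (integrableOn_const hfin.ne) hint.integrableOn hSm
          fun x hx => ?_
        have hx' : |ε| ≤ |u x| := by rwa [abs_of_pos hε0]
        have h1 : f₂ (t * ε) ≤ f₂ (t * u x) := hf.mono_abs (by rw [abs_mul, abs_mul]; gcongr)
        exact mul_le_mul h1 (sq_le_sq.2 hx') (by positivity) (hf.nonneg₂ _)
    _ ≤ fibreDeriv μ f₂ u t :=
        setIntegral_le_integral hint
          (Eventually.of_forall fun x => mul_nonneg (hf.nonneg₂ _) (sq_nonneg _))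

theorem fibre_zero (hf : IsConvexPower r f₁ f₂) (u : α → ℝ) : fibre μ f₁ u 0 = 0 := by
  simp [fibre, hf.zero₁]

theorem fibreDeriv_zero (hf : IsConvexPower r f₁ f₂) (u : α → ℝ) : fibreDeriv μ f₂ u 0 = 0 := by
  simp [fibreDeriv, hf.zero₂]

end IsConvexPower

end Fibre

/-! ### Concave fibre maps in one variable -/

/-- The situation on a ray: `m(t) = t A - H(t)` with `A > 0`, where `H` vanishes to second order at
`0` and `H'` increases strictly from `0` to `∞`.  So `m` is strictly concave on `[0, ∞)`, starts
with slope `A` and tends to `-∞`. -/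
structure IsConcaveFibre (A : ℝ) (H H' : ℝ → ℝ) : Prop where
  pos : 0 < A
  hasDerivAt : ∀ t, HasDerivAt H (H' t) t
  continuous_deriv : Continuous H'
  zero : H 0 = 0
  deriv_zero : H' 0 = 0
  strictMonoOn : StrictMonoOn H' (Ici 0)
  tendsto : Tendsto H' atTop atTop

namespace IsConcaveFibre

variable {A T b : ℝ} {H H' : ℝ → ℝ}

theorem existsUnique_turningPoint (h : IsConcaveFibre A H H') :
    ∃ T, 0 < T ∧ H' T = A ∧ ∀ t, 0 < t → H' t = A → t = T := by
  obtain ⟨R, hR0, hRA⟩ : ∃ R, 0 ≤ R ∧ A ≤ H' R :=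
    ((eventually_ge_atTop 0).and (h.tendsto.eventually_ge_atTop A)).exists
  obtain ⟨T, hT, hTA⟩ := intermediate_value_Icc hR0 h.continuous_deriv.continuousOn
    (show A ∈ Icc (H' 0) (H' R) from ⟨h.deriv_zero.trans_le h.pos.le, hRA⟩)
  have hT0 : T ≠ 0 := by
    rintro rfl
    exact h.pos.ne (h.deriv_zero.symm.trans hTA)
  exact ⟨T, lt_of_le_of_ne hT.1 hT0.symm, hTA, fun t ht htA =>
    h.strictMonoOn.injOn (mem_Ici.2 ht.le) (mem_Ici.2 hT.1) (htA.trans hTA.symm)⟩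

theorem hasDerivAt_sub (h : IsConcaveFibre A H H') (t : ℝ) :
    HasDerivAt (fun t => t * A - H t) (A - H' t) t := by
  exact (((hasDerivAt_id t).mul_const A).sub (h.hasDerivAt t)).congr_deriv (by simp)

theorem continuous_sub (h : IsConcaveFibre A H H') : Continuous fun t => t * A - H t :=
  continuous_iff_continuousAt.2 fun t => (h.hasDerivAt_sub t).continuousAt

theorem strictMonoOn_sub (h : IsConcaveFibre A H H') (hT : 0 < T) (hTA : H' T = A) :
    StrictMonoOn (fun t => t * A - H t) (Icc 0 T) := by
  refine strictMonoOn_of_deriv_pos (convex_Icc 0 T) h.continuous_sub.continuousOn fun t ht => ?_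
  rw [interior_Icc] at ht
  rw [(h.hasDerivAt_sub t).deriv, ← hTA]
  exact sub_pos.2 (h.strictMonoOn (mem_Ici.2 ht.1.le) (mem_Ici.2 hT.le) ht.2)

theorem strictAntiOn_sub (h : IsConcaveFibre A H H') (hT : 0 < T) (hTA : H' T = A) :
    StrictAntiOn (fun t => t * A - H t) (Ici T) := by
  refine strictAntiOn_of_deriv_neg (convex_Ici T) h.continuous_sub.continuousOn fun t ht => ?_
  rw [interior_Ici] at ht
  rw [(h.hasDerivAt_sub t).deriv, ← hTA]
  exact sub_neg.2 (h.strictMonoOn (mem_Ici.2 hT.le) (mem_Ici.2 (hT.trans ht).le) ht)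

theorem sub_le_max (h : IsConcaveFibre A H H') (hT : 0 < T) (hTA : H' T = A) {t : ℝ}
    (ht : 0 ≤ t) : t * A - H t ≤ T * A - H T := by
  rcases le_total t T with htT | hTt
  · exact (h.strictMonoOn_sub hT hTA).monotoneOn ⟨ht, htT⟩ ⟨hT.le, le_rfl⟩ htT
  · exact (h.strictAntiOn_sub hT hTA).antitoneOn (mem_Ici.2 le_rfl) (mem_Ici.2 hTt) hTt

/-- `m(t) = t A - H(t)` takes values below every level: beyond a point where `H' ≥ A + 1` it
decreases at least with slope `-1`. -/
theorem exists_le (h : IsConcaveFibre A H H') (hT : 0 < T) (b : ℝ) :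
    ∃ t, T ≤ t ∧ t * A - H t ≤ b := by
  obtain ⟨R, hR, hRA⟩ : ∃ R, T ≤ R ∧ A + 1 ≤ H' R :=
    ((eventually_ge_atTop T).and (h.tendsto.eventually_ge_atTop (A + 1))).exists
  set c := R * A - H R with hc
  refine ⟨R + max (c - b) 0, by linarith [le_max_right (c - b) 0], ?_⟩
  have key := (convex_Ici R).image_sub_le_mul_sub_of_deriv_le
    (f := fun t => t * A - H t) (C := -1) h.continuous_sub.continuousOn
    (fun t _ => (h.hasDerivAt_sub t).differentiableAt.differentiableWithinAt) (fun t ht => by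
      rw [interior_Ici] at ht
      have := h.strictMonoOn (mem_Ici.2 (hT.le.trans hR))
        (mem_Ici.2 ((hT.le.trans hR).trans ht.le)) ht
      rw [(h.hasDerivAt_sub t).deriv]
      linarith) R (mem_Ici.2 le_rfl) (R + max (c - b) 0)
      (mem_Ici.2 (by linarith [le_max_right (c - b) 0])) (by linarith [le_max_right (c - b) 0])
  linarith [le_max_left (c - b) 0]

theorem exists_descending (h : IsConcaveFibre A H H') (hT : 0 < T)
    (hb : b < T * A - H T) : ∃ t, T < t ∧ t * A - H t = b := by
  obtain ⟨R, hR, hRb⟩ := h.exists_le hT b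
  obtain ⟨t, ht, htb⟩ := intermediate_value_Icc' hR h.continuous_sub.continuousOn
    (show b ∈ Icc _ _ from ⟨hRb, hb.le⟩)
  refine ⟨t, lt_of_le_of_ne ht.1 ?_, htb⟩
  rintro rfl
  exact hb.ne htb.symm

theorem exists_ascending (h : IsConcaveFibre A H H') (hT : 0 < T)
    (hb0 : 0 < b) (hb : b < T * A - H T) : ∃ t, 0 < t ∧ t < T ∧ t * A - H t = b := by
  obtain ⟨t, ht, htb⟩ := intermediate_value_Icc hT.le h.continuous_sub.continuousOn
    (show b ∈ Icc _ _ from ⟨by simpa [h.zero] using hb0.le, hb.le⟩)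
  refine ⟨t, lt_of_le_of_ne ht.1 ?_, lt_of_le_of_ne ht.2 ?_, htb⟩
  · rintro rfl
    simp only [h.zero, zero_mul, sub_zero] at htb
    exact hb0.ne htb
  · rintro rfl
    exact hb.ne htb.symm

theorem lt_deriv_iff (h : IsConcaveFibre A H H') (hT : 0 < T) (hTA : H' T = A) {t : ℝ}
    (ht : 0 < t) : A < H' t ↔ T < t := by
  rw [← hTA]
  exact h.strictMonoOn.lt_iff_lt (mem_Ici.2 hT.le) (mem_Ici.2 ht.le)

theorem deriv_lt_iff (h : IsConcaveFibre A H H') (hT : 0 < T) (hTA : H' T = A) {t : ℝ}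
    (ht : 0 < t) : H' t < A ↔ t < T := by
  rw [← hTA]
  exact h.strictMonoOn.lt_iff_lt (mem_Ici.2 ht.le) (mem_Ici.2 hT.le)

/-- Below the maximum, a level is attained exactly once on the descending branch. -/
theorem existsUnique_descending (h : IsConcaveFibre A H H') (hT : 0 < T) (hTA : H' T = A)
    (hb : b < T * A - H T) : ∃! t, 0 < t ∧ t * A - H t = b ∧ A < H' t := by
  obtain ⟨t, htT, htb⟩ := h.exists_descending hT hb
  refine ⟨t, ⟨hT.trans htT, htb, (h.lt_deriv_iff hT hTA (hT.trans htT)).2 htT⟩, ?_⟩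
  rintro s ⟨hs0, hsb, hsA⟩
  exact (h.strictAntiOn_sub hT hTA).injOn (mem_Ici.2 ((h.lt_deriv_iff hT hTA hs0).1 hsA).le)
    (mem_Ici.2 htT.le) (hsb.trans htb.symm)

/-- A positive level below the maximum is attained exactly once on the ascending branch. -/
theorem existsUnique_ascending (h : IsConcaveFibre A H H') (hT : 0 < T) (hTA : H' T = A)
    (hb0 : 0 < b) (hb : b < T * A - H T) : ∃! t, 0 < t ∧ t * A - H t = b ∧ H' t < A := by
  obtain ⟨t, ht0, htT, htb⟩ := h.exists_ascending hT hb0 hb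
  refine ⟨t, ⟨ht0, htb, (h.deriv_lt_iff hT hTA ht0).2 htT⟩, ?_⟩
  rintro s ⟨hs0, hsb, hsA⟩
  exact (h.strictMonoOn_sub hT hTA).injOn ⟨hs0.le, ((h.deriv_lt_iff hT hTA hs0).1 hsA).le⟩
    ⟨ht0.le, htT.le⟩ (hsb.trans htb.symm)

theorem deriv_ne_of_level (hTA : ∀ t, 0 < t → H' t = A → t = T) (hb : b < T * A - H T) {t : ℝ}
    (ht : 0 < t) (htb : t * A - H t = b) : H' t ≠ A := fun h => by
  rw [hTA t ht h] at htb
  exact hb.ne htb.symm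

theorem pos_of_deriv_lt (h : IsConcaveFibre A H H') (hT : 0 < T) (hTA : H' T = A) {t : ℝ}
    (ht : 0 < t) (htb : t * A - H t = b) (htA : H' t < A) : 0 < b := by
  rw [← htb]
  simpa [h.zero] using h.strictMonoOn_sub hT hTA ⟨le_rfl, hT.le⟩
    ⟨ht.le, ((h.deriv_lt_iff hT hTA ht).1 htA).le⟩ ht

theorem lt_iff_of_descending (h : IsConcaveFibre A H H') (hT : 0 < T) (hTA : H' T = A) {s t : ℝ}
    (hs : 0 < s) (hsA : A < H' s) (ht : 0 < t) (htA : A < H' t) :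
    s * A - H s < t * A - H t ↔ t < s :=
  (h.strictAntiOn_sub hT hTA).lt_iff_gt (mem_Ici.2 ((h.lt_deriv_iff hT hTA hs).1 hsA).le)
    (mem_Ici.2 ((h.lt_deriv_iff hT hTA ht).1 htA).le)

end IsConcaveFibre

/-! ### Regularity of implicitly defined scalars -/

/-- A scalar `τ(x)` which is locally the only solution of `F(x, t) = 0` is of class `C^1` where
`∂F/∂t ≠ 0`. -/
theorem contDiffAt_of_unique_zero {E : Type*} [NormedAddCommGroup E] [NormedSpace ℝ E]
    [CompleteSpace E] {F : E × ℝ → ℝ} (hF : ContDiff ℝ 1 F) {τ : E → ℝ} {x : E} {c : ℝ}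
    (h0 : F (x, τ x) = 0) (hc : HasDerivAt (fun t => F (x, t)) c (τ x)) (hc0 : c ≠ 0)
    (huniq : ∀ᶠ z in 𝓝 (x, τ x), F z = 0 → z.2 = τ z.1) : ContDiffAt ℝ 1 τ x := by
  have hd : HasFDerivAt F (fderiv ℝ F (x, τ x)) (x, τ x) :=
    (hF.differentiable one_ne_zero _).hasFDerivAt
  have hone : fderiv ℝ F (x, τ x) (0, 1) = c := by
    have h1 : HasDerivAt (fun t : ℝ => (x, t)) ((0 : E), (1 : ℝ)) (τ x) :=
      (hasDerivAt_const _ _).prodMk (hasDerivAt_id _)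
    exact (hd.comp_hasDerivAt (τ x) h1).unique hc
  have hinv : (fderiv ℝ F (x, τ x) ∘L .inr ℝ E ℝ).IsInvertible := by
    refine ⟨ContinuousLinearEquiv.unitsEquivAut ℝ (Units.mk0 c hc0), ?_⟩
    ext
    simp [hone]
  have hcd : ContDiffAt ℝ 1 F (x, τ x) := hF.contDiffAt
  have hψ := hcd.contDiffAt_implicitFunction one_ne_zero hinv
  refine hψ.congr_of_eventuallyEq ?_
  have hself : hcd.implicitFunction one_ne_zero hinv x = τ x :=
    hcd.implicitFunction_apply_self one_ne_zero hinv
  have htend : Tendsto (fun y => (y, hcd.implicitFunction one_ne_zero hinv y)) (𝓝 x)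
      (𝓝 (x, τ x)) := by
    have := (continuousAt_id (x := x)).prodMk hψ.continuousAt
    simpa [ContinuousAt, hself] using this
  filter_upwards [htend.eventually huniq,
    hcd.eventually_apply_implicitFunction one_ne_zero hinv] with y hy1 hy2
  exact (hy1 (hy2.trans h0)).symm

/-! ### The space `𝒟^{1,2}` and its quadratic form -/

namespace D12

variable {N : ℕ} [Fact (3 ≤ N)]

theorem norm_eq (u : D12 N) : ‖u‖ = ‖grad u‖ := rfl

theorem exists_norm_fn_le (N : ℕ) [Fact (3 ≤ N)] :
    ∃ C, 0 < C ∧ ∀ u : D12 N, ‖fn u‖ ≤ C * ‖u‖ := by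
  obtain ⟨C, hC⟩ := sobolev_pairs N
  refine ⟨max C 1, lt_max_of_lt_right one_pos, fun u => (hC u.1 u.2).trans ?_⟩
  exact mul_le_mul_of_nonneg_right (le_max_left _ _) (norm_nonneg _)

/-- The embedding of `𝒟^{1,2}` in `L^{2^*}`. -/
noncomputable def fnL : D12 N →L[ℝ] LCrit N where
  toLinearMap := fn
  cont := by
    obtain ⟨C, -, hC⟩ := exists_norm_fn_le N
    exact AddMonoidHomClass.continuous_of_bound (fn : D12 N →ₗ[ℝ] LCrit N) C hC

/-- The gradient as an isometric embedding of `𝒟^{1,2}` in `L^2`. -/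
noncomputable def gradL : D12 N →L[ℝ] LGrad N where
  toLinearMap := grad
  cont := AddMonoidHomClass.continuous_of_bound (grad : D12 N →ₗ[ℝ] LGrad N) 1 fun u => by
    rw [one_mul, norm_eq]

theorem fnL_apply (u : D12 N) : fnL u = fn u := rfl

theorem gradL_apply (u : D12 N) : gradL u = grad u := rfl

/-- A Cauchy sequence for the gradient norm is Cauchy in `L^{2^*} × L^2`, by the Sobolev inequality,
and the pairs form a closed subspace there. -/
instance : CompleteSpace (D12 N) := by
  refine Metric.complete_of_cauchySeq_tendsto fun w hw => ?_
  obtain ⟨a, ha⟩ := cauchySeq_tendsto_of_complete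
    ((fnL (N := N)).uniformContinuous.comp_cauchySeq hw)
  obtain ⟨b, hb⟩ := cauchySeq_tendsto_of_complete
    ((gradL (N := N)).uniformContinuous.comp_cauchySeq hw)
  have hmem : (a, b) ∈ pairs N :=
    (Submodule.isClosed_topologicalClosure (testPairs N)).mem_of_tendsto
      (ha.prodMk_nhds hb) (Eventually.of_forall fun n => (w n).2)
  let z : D12 N := ⟨(a, b), hmem⟩
  refine ⟨z, ?_⟩
  rw [tendsto_iff_norm_sub_tendsto_zero]
  refine (tendsto_iff_norm_sub_tendsto_zero.1 hb).congr fun n => ?_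
  rw [norm_eq, map_sub]
  rfl

theorem integral_norm_grad_sq (u : D12 N) : ∫ x, ‖grad u x‖ ^ 2 = ‖u‖ ^ 2 := by
  rw [norm_eq, ← real_inner_self_eq_norm_sq, L2.inner_def]
  simp only [real_inner_self_eq_norm_sq]

end D12

variable {N : ℕ} [Fact (3 ≤ N)]

theorem holderConjugate_dualExp_critExp (N : ℕ) [Fact (3 ≤ N)] :
    (dualExp N).HolderConjugate (critExp N) := by
  have h := three_le_cast N
  have h1 : (N : ℝ) - 2 ≠ 0 := by linarith
  have h2 : (N : ℝ) + 2 ≠ 0 := by linarith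
  have h3 : (N : ℝ) ≠ 0 := by linarith
  refine ⟨?_, ?_, ?_⟩
  · unfold dualExp critExp
    field_simp
    ring
  · linarith [one_le_dualExp N]
  · linarith [one_le_critExp N]

theorem holderTriple_critExp (N : ℕ) [Fact (3 ≤ N)] :
    ((N : ℝ) / 2).HolderTriple (critExp N) (dualExp N) := by
  have h := three_le_cast N
  have h1 : (N : ℝ) - 2 ≠ 0 := by linarith
  have h2 : (N : ℝ) + 2 ≠ 0 := by linarith
  have h3 : (N : ℝ) ≠ 0 := by linarith
  refine ⟨?_, ?_, ?_⟩
  · unfold dualExp critExp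
    field_simp
    ring
  · linarith
  · linarith [one_le_critExp N]

theorem exists_pairingCLM (N : ℕ) [Fact (3 ≤ N)] :
    ∃ P : LDual N →L[ℝ] LCrit N →L[ℝ] ℝ,
      (∀ g v, P g v = ∫ x, g x * v x) ∧ ∀ g v, |P g v| ≤ ‖g‖ * ‖v‖ := by
  have := (holderConjugate_dualExp_critExp N).ennrealOfReal
  refine ⟨(ContinuousLinearMap.mul ℝ ℝ).lpPairing volume (ENNReal.ofReal (dualExp N))
    (ENNReal.ofReal (critExp N)), fun g v => by
      rw [ContinuousLinearMap.lpPairing_eq_integral]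
      rfl, fun g v => ?_⟩
  rw [ContinuousLinearMap.lpPairing_eq_integral,
    ← integral_congr_ae ((ContinuousLinearMap.mul ℝ ℝ).coeFn_holder (r := 1) g v),
    ← L1.integral_eq_integral, ← Real.norm_eq_abs]
  refine (L1.norm_integral_le _).trans
    ((ContinuousLinearMap.norm_holder_apply_apply_le _ _ _).trans ?_)
  simp

/-- The second component of a pair in the closure is the weak gradient of the first one. -/
theorem integral_mul_inner_grad_eq {w : LCrit N × LGrad N} (hw : w ∈ pairs N) {ψ : RN N → ℝ}
    (hψ : ContDiff ℝ ∞ ψ) (hψc : HasCompactSupport ψ) (v : RN N) :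
    ∫ x, inner ℝ (ψ x • v) (w.2 x) = -∫ x, fderiv ℝ ψ x v * w.1 x := by
  obtain ⟨P, hP, -⟩ := exists_pairingCLM N
  have hψd : ∀ x, DifferentiableAt ℝ ψ x := hψ.differentiable (by simp)
  have hdc : Continuous fun x => fderiv ℝ ψ x v :=
    (hψ.continuous_fderiv (by simp)).clm_apply continuous_const
  have hds : HasCompactSupport fun x => fderiv ℝ ψ x v :=
    (hψc.fderiv ℝ).comp_left (g := fun L : RN N →L[ℝ] ℝ => L v) (by simp)
  have hm1 : MemLp (fun x => ψ x • v) 2 (volume : Measure (RN N)) :=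
    (hψ.continuous.smul continuous_const).memLp_of_hasCompactSupport hψc.smul_right
  have hm2 : MemLp (fun x => fderiv ℝ ψ x v) (ENNReal.ofReal (dualExp N))
    (volume : Measure (RN N)) := hdc.memLp_of_hasCompactSupport hds
  have e1 : ∀ w : LCrit N × LGrad N,
      inner ℝ hm1.toLp w.2 = ∫ x, inner ℝ (ψ x • v) (w.2 x) := fun w => by
    rw [L2.inner_def]
    refine integral_congr_ae ?_
    filter_upwards [hm1.coeFn_toLp] with x hx
    rw [hx]
  have e2 : ∀ w : LCrit N × LGrad N, P hm2.toLp w.1 = ∫ x, fderiv ℝ ψ x v * w.1 x := fun w => by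
    rw [hP]
    refine integral_congr_ae ?_
    filter_upwards [hm2.coeFn_toLp] with x hx
    rw [hx]
  have hcl : IsClosed {w : LCrit N × LGrad N | inner ℝ hm1.toLp w.2 = -P hm2.toLp w.1} :=
    isClosed_eq (by fun_prop) (by fun_prop)
  rw [← e1, ← e2]
  refine closure_minimal ?_ hcl hw
  rintro a ⟨φ, h1, h2, h3, h4⟩
  have hφd : ∀ x, DifferentiableAt ℝ φ x := h1.differentiable (by simp)
  change inner ℝ hm1.toLp a.2 = -P hm2.toLp a.1
  have hφc : Continuous fun x => fderiv ℝ φ x v :=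
    (h1.continuous_fderiv (by simp)).clm_apply continuous_const
  rw [e1, e2]
  calc ∫ x, inner ℝ (ψ x • v) (a.2 x) = ∫ x, ψ x * fderiv ℝ φ x v := by
        refine integral_congr_ae ?_
        filter_upwards [h4] with x hx
        rw [hx, real_inner_smul_left, inner_gradient_right]
        simp
    _ = -∫ x, fderiv ℝ ψ x v * φ x :=
        integral_mul_fderiv_eq_neg_fderiv_mul_of_integrable
          ((hdc.mul h1.continuous).integrable_of_hasCompactSupport hds.mul_right)
          ((hψ.continuous.mul hφc).integrable_of_hasCompactSupport hψc.mul_right)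
          ((hψ.continuous.mul h1.continuous).integrable_of_hasCompactSupport hψc.mul_right)
          (fun x _ => hψd x) (fun x _ => hφd x)
    _ = _ := by
        congr 1
        refine integral_congr_ae ?_
        filter_upwards [h3] with x hx
        rw [hx]

/-- An element of `𝒟^{1,2}` is determined by its underlying function, because the gradient
component is its weak gradient. -/
theorem D12.fn_ne_zero {u : D12 N} (hu : u ≠ 0) : D12.fn u ≠ 0 := by
  refine fun h0 => hu (D12.grad_injective ?_)
  rw [map_zero]
  have hloc : LocallyIntegrable (D12.grad u) (volume : Measure (RN N)) :=
    (Lp.memLp (D12.grad u)).locallyIntegrable (by norm_num)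
  refine (Lp.eq_zero_iff_ae_eq_zero).2
    (ae_eq_zero_of_integral_contDiff_smul_eq_zero hloc fun ψ hψ hψc => ?_)
  have hint : Integrable (fun x => ψ x • D12.grad u x) (volume : Measure (RN N)) :=
    hloc.integrable_smul_left_of_hasCompactSupport hψ.continuous hψc
  refine ext_inner_left ℝ fun v => ?_
  rw [← integral_inner hint, inner_zero_right]
  have h := integral_mul_inner_grad_eq u.2 hψ hψc v
  have hz : ∫ x, fderiv ℝ ψ x v * D12.fn u x = 0 := by
    rw [h0]
    refine integral_eq_zero_of_ae ?_
    filter_upwards [Lp.coeFn_zero ℝ (ENNReal.ofReal (critExp N)) (volume : Measure (RN N))]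
      with x hx
    rw [hx]
    simp
  rw [show ∫ x, fderiv ℝ ψ x v * (u.1 : LCrit N × LGrad N).1 x = 0 from hz, neg_zero] at h
  rw [← h]
  refine integral_congr_ae (Eventually.of_forall fun x => ?_)
  change inner ℝ v (ψ x • D12.grad u x) = inner ℝ (ψ x • v) (D12.grad u x)
  rw [real_inner_smul_left, real_inner_smul_right]

/-- The form `∫ V u v` is bounded on `L^{2^*}` with norm at most `‖V‖_{N/2}`. -/
theorem exists_potentialCLM {V : RN N → ℝ}
    (hV : MemLp V (ENNReal.ofReal ((N : ℝ) / 2)) volume) :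
    ∃ B : LCrit N →L[ℝ] LCrit N →L[ℝ] ℝ,
      (∀ v, B v v = ∫ x, V x * v x ^ 2) ∧
      ∀ v, |B v v| ≤ (eLpNorm V (ENNReal.ofReal ((N : ℝ) / 2)) volume).toReal * ‖v‖ ^ 2 := by
  have hN := three_le_cast N
  obtain ⟨P, hP, hPle⟩ := exists_pairingCLM N
  have := (holderTriple_critExp N).ennrealOfReal
  have : Fact (1 ≤ ENNReal.ofReal ((N : ℝ) / 2)) := ⟨by
    simpa using ENNReal.ofReal_le_ofReal (show (1 : ℝ) ≤ (N : ℝ) / 2 by linarith)⟩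
  set W : LCrit N →L[ℝ] LDual N := (ContinuousLinearMap.mul ℝ ℝ).holderL volume
    (ENNReal.ofReal ((N : ℝ) / 2)) (ENNReal.ofReal (critExp N)) (ENNReal.ofReal (dualExp N))
    hV.toLp
  have hWv : ∀ v, W v = (ContinuousLinearMap.mul ℝ ℝ).holder (ENNReal.ofReal (dualExp N))
    hV.toLp v := fun v => rfl
  refine ⟨P ∘L W, fun v => ?_, fun v => ?_⟩
  · rw [ContinuousLinearMap.comp_apply, hP, hWv]
    refine integral_congr_ae ?_
    filter_upwards [(ContinuousLinearMap.mul ℝ ℝ).coeFn_holder (r := ENNReal.ofReal (dualExp N))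
      hV.toLp v, hV.coeFn_toLp] with x h1 h2
    rw [h1, h2, ContinuousLinearMap.mul_apply']
    ring
  · refine (hPle _ _).trans ?_
    rw [pow_two, ← mul_assoc, ← Lp.norm_toLp V hV]
    refine mul_le_mul_of_nonneg_right ?_ (norm_nonneg v)
    refine (ContinuousLinearMap.norm_holder_apply_apply_le (r := ENNReal.ofReal (dualExp N))
      (ContinuousLinearMap.mul ℝ ℝ) hV.toLp v).trans ?_
    simp

theorem sobolevConst_mul_le (u : D12 N) : sobolevConst N * ‖D12.fn u‖ ^ 2 ≤ ‖u‖ ^ 2 := by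
  rcases eq_or_ne u 0 with rfl | hu
  · simp
  have hr : 0 < critExp N := by linarith [one_le_critExp N]
  have hbdd : BddBelow (range fun u : {u : D12 N // u ≠ 0} =>
      (∫ x, ‖D12.grad u.1 x‖ ^ 2) /
        (∫ x, |D12.fn u.1 x| ^ critExp N) ^ (2 / critExp N)) := by
    refine ⟨0, ?_⟩
    rintro _ ⟨w, rfl⟩
    exact div_nonneg (integral_nonneg fun x => by positivity)
      (Real.rpow_nonneg (integral_nonneg fun x => by positivity) _)
  have h := ciInf_le hbdd ⟨u, hu⟩
  have hn : (∫ x, |D12.fn u x| ^ critExp N) ^ (2 / critExp N) = ‖D12.fn u‖ ^ 2 := by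
    rw [← Lp.norm_rpow_eq_integral hr, ← Real.rpow_mul (norm_nonneg _),
      mul_div_cancel₀ _ hr.ne']
    norm_num
  change sobolevConst N ≤ _ at h
  simp only [hn, D12.integral_norm_grad_sq] at h
  -- a vanishing denominator makes the quotient in `h` meaningless, but the claim trivial
  rcases eq_or_ne (‖D12.fn u‖ ^ 2) 0 with h0 | h0
  · rw [h0, mul_zero]
    positivity
  · rwa [le_div_iff₀ (lt_of_le_of_ne (by positivity) h0.symm)] at h

theorem contDiff_normSqV {V : RN N → ℝ} (hV : MemLp V (ENNReal.ofReal ((N : ℝ) / 2)) volume) :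
    ContDiff ℝ 1 (normSqV (N := N) V) := by
  obtain ⟨B, hB, -⟩ := exists_potentialCLM hV
  have h : normSqV (N := N) V = fun u => ‖D12.gradL u‖ ^ 2 + B (D12.fnL u) (D12.fnL u) := by
    funext u
    rw [normSqV, D12.integral_norm_grad_sq, hB, D12.fnL_apply, D12.gradL_apply,
      D12.norm_eq]
  rw [h]
  exact (D12.gradL.contDiff.norm_sq ℝ).add
    ((B.contDiff.comp D12.fnL.contDiff).clm_apply D12.fnL.contDiff)

/-- As `‖V‖_{N/2} < S`, the quadratic form `‖u‖_V^2` is coercive. -/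
theorem exists_normSqV_ge {V : RN N → ℝ}
    (hV : MemLp V (ENNReal.ofReal ((N : ℝ) / 2)) volume)
    (hVS : eLpNorm V (ENNReal.ofReal ((N : ℝ) / 2)) volume < ENNReal.ofReal (sobolevConst N)) :
    ∃ a, 0 < a ∧ ∀ u : D12 N, a * ‖u‖ ^ 2 ≤ normSqV V u := by
  obtain ⟨B, hB, hBle⟩ := exists_potentialCLM hV
  set v := (eLpNorm V (ENNReal.ofReal ((N : ℝ) / 2)) volume).toReal with hv
  have hS : 0 < sobolevConst N := ENNReal.ofReal_pos.1 (pos_of_gt hVS)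
  have hvS : v < sobolevConst N := by
    rwa [hv, ← ENNReal.lt_ofReal_iff_toReal_lt hV.eLpNorm_ne_top]
  refine ⟨1 - v / sobolevConst N, sub_pos.2 ((div_lt_one hS).2 hvS), fun u => ?_⟩
  have h1 := sobolevConst_mul_le u
  have h2 := (abs_le.1 (hBle (D12.fn u))).1
  rw [hB] at h2
  have h3 : v * ‖D12.fn u‖ ^ 2 ≤ v / sobolevConst N * ‖u‖ ^ 2 := by
    have : 0 ≤ v / sobolevConst N := by positivity
    calc v * ‖D12.fn u‖ ^ 2 = v / sobolevConst N * (sobolevConst N * ‖D12.fn u‖ ^ 2) := by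
          field_simp
      _ ≤ _ := by gcongr
  rw [normSqV, D12.integral_norm_grad_sq, sub_mul, one_mul]
  linarith

/-! ### Rays in `𝒟^{1,2}` -/

section Rays

variable {N : ℕ} [Fact (3 ≤ N)] {V : RN N → ℝ} {f : ℝ → ℝ}

theorem normSqV_smul (V : RN N → ℝ) (t : ℝ) (u : D12 N) :
    normSqV V (t • u) = t ^ 2 * normSqV V u := by
  have h : ∫ x, V x * D12.fn (t • u) x ^ 2 = t ^ 2 * ∫ x, V x * D12.fn u x ^ 2 := by
    rw [← integral_const_mul, map_smul]
    refine integral_congr_ae ?_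
    filter_upwards [Lp.coeFn_smul t (D12.fn u)] with x hx
    rw [hx, Pi.smul_apply, smul_eq_mul]
    ring
  rw [normSqV, normSqV, h, D12.integral_norm_grad_sq, D12.integral_norm_grad_sq, norm_smul,
    mul_pow, Real.norm_eq_abs, sq_abs]
  ring

theorem pairing_smul (g : LDual N) (t : ℝ) (u : D12 N) :
    pairing g (t • u) = t * pairing g u := by
  rw [pairing, pairing, ← integral_const_mul, map_smul]
  refine integral_congr_ae ?_
  filter_upwards [Lp.coeFn_smul t (D12.fn u)] with x hx
  rw [hx, Pi.smul_apply, smul_eq_mul]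
  ring

theorem integral_smul_eq_fibre (f₁ : ℝ → ℝ) (t : ℝ) (u : D12 N) :
    ∫ x, f₁ (D12.fn (t • u) x) * D12.fn (t • u) x = t * fibre volume f₁ (D12.fn u) t := by
  rw [fibre, ← integral_const_mul, map_smul]
  refine integral_congr_ae ?_
  filter_upwards [Lp.coeFn_smul t (D12.fn u)] with x hx
  rw [hx, Pi.smul_apply, smul_eq_mul]
  ring

theorem integral_smul_eq_fibreDeriv (f₂ : ℝ → ℝ) (t : ℝ) (u : D12 N) :
    ∫ x, f₂ (D12.fn (t • u) x) * D12.fn (t • u) x ^ 2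
      = t ^ 2 * fibreDeriv volume f₂ (D12.fn u) t := by
  rw [fibreDeriv, ← integral_const_mul, map_smul]
  refine integral_congr_ae ?_
  filter_upwards [Lp.coeFn_smul t (D12.fn u)] with x hx
  rw [hx, Pi.smul_apply, smul_eq_mul]
  ring

theorem smul_mem_nehari_iff {u : D12 N} (hu : u ≠ 0) (g : LDual N) {t : ℝ} (ht : 0 < t) :
    t • u ∈ nehari V f g ↔
      t * normSqV V u - fibre volume (deriv f) (D12.fn u) t = pairing g u := by
  change _ ∧ _ ↔ _
  rw [integral_smul_eq_fibre, normSqV_smul, pairing_smul, pow_two, mul_assoc, ← mul_sub, ← mul_sub,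
    mul_eq_zero, or_iff_right ht.ne', sub_eq_zero, and_iff_right (smul_ne_zero ht.ne' hu)]

theorem smul_mem_inflection_iff {u : D12 N} (hu : u ≠ 0) {t : ℝ} (ht : 0 < t) :
    t • u ∈ inflection V f ↔
      fibreDeriv volume (iteratedDeriv 2 f) (D12.fn u) t = normSqV V u := by
  change _ ∧ _ ↔ _
  rw [integral_smul_eq_fibreDeriv, normSqV_smul, ← mul_sub, mul_eq_zero,
    or_iff_right (pow_pos ht 2).ne', sub_eq_zero, and_iff_right (smul_ne_zero ht.ne' hu), eq_comm]

theorem isConcaveFibre (hV : MemLp V (ENNReal.ofReal ((N : ℝ) / 2)) volume)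
    (hVS : eLpNorm V (ENNReal.ofReal ((N : ℝ) / 2)) volume < ENNReal.ofReal (sobolevConst N))
    (hf : IsDoublePower N f) {u : D12 N} (hu : u ≠ 0) :
    IsConcaveFibre (normSqV V u) (fibre volume (deriv f) (D12.fn u))
      (fibreDeriv volume (iteratedDeriv 2 f) (D12.fn u)) := by
  have hc := hf.isConvexPower
  have hr := two_lt_critExp N
  obtain ⟨a, ha, hau⟩ := exists_normSqV_ge hV hVS
  exact ⟨(mul_pos ha (pow_pos (norm_pos_iff.2 hu) 2)).trans_le (hau u), hc.hasDerivAt_fibre hr _,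
    hc.continuous_fibreDeriv hr _, hc.fibre_zero _, hc.fibreDeriv_zero _,
    hc.strictMonoOn_fibreDeriv hr (D12.fn_ne_zero hu), hc.tendsto_fibreDeriv hr (D12.fn_ne_zero hu)⟩

/-- If `‖g‖` is small, the level `∫ g u` lies below the maximum of the fibre map, uniformly
in `u`: both sides are homogeneous in `u`, and on the sphere of small radius `ρ` the coercive
quadratic term dominates. -/
theorem exists_pairing_lt_max (hV : MemLp V (ENNReal.ofReal ((N : ℝ) / 2)) volume)
    (hVS : eLpNorm V (ENNReal.ofReal ((N : ℝ) / 2)) volume < ENNReal.ofReal (sobolevConst N))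
    (hf : IsDoublePower N f) :
    ∃ δ, 0 < δ ∧ ∀ (u : D12 N) (g : LDual N), u ≠ 0 → ‖g‖ < δ → ∃ t, 0 < t ∧
      pairing g u < t * normSqV V u - fibre volume (deriv f) (D12.fn u) t := by
  have hr := two_lt_critExp N
  obtain ⟨a, ha, hau⟩ := exists_normSqV_ge hV hVS
  obtain ⟨K, hK, hKu⟩ := D12.exists_norm_fn_le N
  obtain ⟨C, hC0, hC⟩ := hf.isConvexPower.abs_fibre_le (μ := (volume : Measure (RN N))) hr
  obtain ⟨P, hP, hPle⟩ := exists_pairingCLM N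
  set r := critExp N
  have hr2 : 0 < r - 2 := by linarith
  set c := a / (2 * (C * K ^ r + 1)) with hc
  have hc0 : 0 < c := by positivity
  -- `ρ` is chosen so that `C K ^ r ρ ^ (r - 1) ≤ (a / 2) ρ`, with `+ 1` in `c` as `C` may vanish
  set ρ := c ^ (r - 2)⁻¹ with hρ
  have hρ0 : 0 < ρ := Real.rpow_pos_of_pos hc0 _
  have hρc : ρ ^ (r - 2) = c := by
    rw [hρ, ← Real.rpow_mul hc0.le, inv_mul_cancel₀ hr2.ne', Real.rpow_one]
  have hsmall : C * K ^ r * ρ ^ (r - 1) ≤ a / 2 * ρ := by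
    rw [show r - 1 = r - 2 + 1 by ring, Real.rpow_add_one hρ0.ne', hρc, ← mul_assoc]
    refine mul_le_mul_of_nonneg_right ?_ hρ0.le
    have h1 : (C * K ^ r + 1) * c = a / 2 := by
      rw [hc]
      field_simp
    linarith
  refine ⟨a * ρ / (2 * K), by positivity, fun u g hu hg => ?_⟩
  have hu0 : 0 < ‖u‖ := norm_pos_iff.2 hu
  refine ⟨ρ / ‖u‖, by positivity, ?_⟩
  have h1 : a * ρ * ‖u‖ ≤ ρ / ‖u‖ * normSqV V u := by
    calc a * ρ * ‖u‖ = ρ / ‖u‖ * (a * ‖u‖ ^ 2) := by field_simp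
      _ ≤ _ := by
        have := hau u
        gcongr
  have h2 : fibre volume (deriv f) (D12.fn u) (ρ / ‖u‖) ≤ a / 2 * ρ * ‖u‖ := by
    refine (le_abs_self _).trans ((hC _ _).trans ?_)
    have hpow : ‖D12.fn u‖ ^ r ≤ K ^ r * (‖u‖ ^ (r - 1) * ‖u‖) := by
      rw [← Real.rpow_add_one hu0.ne', sub_add_cancel, ← Real.mul_rpow hK.le hu0.le]
      exact Real.rpow_le_rpow (norm_nonneg _) (hKu u) (by linarith)
    calc C * |ρ / ‖u‖| ^ (r - 1) * ‖D12.fn u‖ ^ r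
        ≤ C * |ρ / ‖u‖| ^ (r - 1) * (K ^ r * (‖u‖ ^ (r - 1) * ‖u‖)) := by gcongr
      _ = C * K ^ r * ρ ^ (r - 1) * ‖u‖ := by
          have : ‖u‖ ^ (r - 1) ≠ 0 := (Real.rpow_pos_of_pos hu0 _).ne'
          rw [abs_of_pos (by positivity), Real.div_rpow hρ0.le hu0.le]
          field_simp
      _ ≤ _ := by gcongr
  have h3 : pairing g u < a / 2 * ρ * ‖u‖ := by
    calc pairing g u ≤ ‖g‖ * ‖D12.fn u‖ := (le_abs_self _).trans (by
          rw [pairing, ← hP]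
          exact hPle g (D12.fn u))
      _ ≤ ‖g‖ * (K * ‖u‖) := by
          have := hKu u
          gcongr
      _ < a * ρ / (2 * K) * (K * ‖u‖) := by gcongr
      _ = _ := by field_simp
  linarith

theorem continuous_pairing : Continuous fun z : D12 N × LDual N => pairing z.2 z.1 := by
  obtain ⟨P, hP, -⟩ := exists_pairingCLM N
  have h : (fun z : D12 N × LDual N => pairing z.2 z.1) = fun z => P z.2 (D12.fnL z.1) := by
    funext z
    rw [hP]
    rfl
  rw [h]
  fun_prop

/-- The function of `((u, g), t)` whose zeros with `t > 0` are the points `t u ∈ 𝒩_g^V`. -/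
noncomputable def nehariMap (V : RN N → ℝ) (f : ℝ → ℝ) (z : (D12 N × LDual N) × ℝ) : ℝ :=
  normSqV V (z.2 • z.1.1) -
    (∫ x, deriv f (D12.fn (z.2 • z.1.1) x) * D12.fn (z.2 • z.1.1) x) -
    pairing z.1.2 (z.2 • z.1.1)

theorem nehariMap_apply (z : D12 N × LDual N) (t : ℝ) : nehariMap V f (z, t) =
    t * (t * normSqV V z.1 - fibre volume (deriv f) (D12.fn z.1) t - pairing z.2 z.1) := by
  rw [nehariMap, normSqV_smul, integral_smul_eq_fibre, pairing_smul]
  ring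

theorem contDiff_nehariMap (hV : MemLp V (ENNReal.ofReal ((N : ℝ) / 2)) volume)
    (hf : IsDoublePower N f) : ContDiff ℝ 1 (nehariMap (N := N) V f) := by
  obtain ⟨P, hP, -⟩ := exists_pairingCLM N
  have hs : ContDiff ℝ 1 fun z : (D12 N × LDual N) × ℝ => z.2 • z.1.1 :=
    contDiff_snd.smul contDiff_fst.fst
  have hG := (hf.isConvexPower.contDiff_integral (two_lt_critExp N)
    (μ := (volume : Measure (RN N)))).comp (D12.fnL.contDiff.comp hs)
  have hp : ContDiff ℝ 1 fun z : (D12 N × LDual N) × ℝ => pairing z.1.2 (z.2 • z.1.1) := by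
    have h : (fun z : (D12 N × LDual N) × ℝ => pairing z.1.2 (z.2 • z.1.1))
        = fun z => P z.1.2 (D12.fnL (z.2 • z.1.1)) := by
      funext z
      rw [hP]
      rfl
    rw [h]
    exact (P.contDiff.comp contDiff_fst.snd).clm_apply (D12.fnL.contDiff.comp hs)
  exact (((contDiff_normSqV hV).comp hs).sub hG).sub hp

theorem hasDerivAt_nehariMap (hf : IsDoublePower N f) (z : D12 N × LDual N) (t : ℝ) :
    HasDerivAt (fun t => nehariMap V f (z, t))
      ((t * normSqV V z.1 - fibre volume (deriv f) (D12.fn z.1) t - pairing z.2 z.1) +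
        t * (normSqV V z.1 - fibreDeriv volume (iteratedDeriv 2 f) (D12.fn z.1) t)) t := by
  simp only [nehariMap_apply]
  have h := hf.isConvexPower.hasDerivAt_fibre (two_lt_critExp N) (D12.fn z.1) t
  exact ((hasDerivAt_id t).mul ((((hasDerivAt_id t).mul_const _).sub h).sub_const _)).congr_deriv
    (by simp)

/-- On each branch, that is, where `∂/∂t` of the fibre map has the sign `σ`, the solution `t` is of
class `C^1` in `(u, g)`.  The sign persists nearby, so that the implicit function stays on the
branch. -/
theorem contDiffOn_branch (hV : MemLp V (ENNReal.ofReal ((N : ℝ) / 2)) volume)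
    (hf : IsDoublePower N f) {U : Set (D12 N × LDual N)} (hU : IsOpen U) (σ : ℝ)
    {τ : D12 N × LDual N → ℝ}
    (hτ : ∀ z ∈ U, 0 < τ z ∧
      τ z * normSqV V z.1 - fibre volume (deriv f) (D12.fn z.1) (τ z) = pairing z.2 z.1 ∧
      0 < σ * (normSqV V z.1 - fibreDeriv volume (iteratedDeriv 2 f) (D12.fn z.1) (τ z)))
    (huniq : ∀ z ∈ U, ∀ t, 0 < t →
      t * normSqV V z.1 - fibre volume (deriv f) (D12.fn z.1) t = pairing z.2 z.1 →
      0 < σ * (normSqV V z.1 - fibreDeriv volume (iteratedDeriv 2 f) (D12.fn z.1) t) →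
      t = τ z) : ContDiffOn ℝ 1 τ U := by
  intro z hz
  have hF := contDiff_nehariMap (N := N) hV hf
  obtain ⟨ht0, htb, htσ⟩ := hτ z hz
  have hdF : ∀ (y : D12 N × LDual N) (t : ℝ), fderiv ℝ (nehariMap V f) (y, t) (0, 1) =
      (t * normSqV V y.1 - fibre volume (deriv f) (D12.fn y.1) t - pairing y.2 y.1) +
        t * (normSqV V y.1 - fibreDeriv volume (iteratedDeriv 2 f) (D12.fn y.1) t) := fun y t => by
    have h1 : HasDerivAt (fun s : ℝ => (y, s)) ((0 : D12 N × LDual N), (1 : ℝ)) t :=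
      (hasDerivAt_const _ _).prodMk (hasDerivAt_id _)
    exact ((hF.differentiable one_ne_zero (y, t)).hasFDerivAt.comp_hasDerivAt t h1).unique
      (hasDerivAt_nehariMap hf y t)
  have hcont : Continuous fun w => σ * fderiv ℝ (nehariMap (N := N) V f) w (0, 1) :=
    continuous_const.mul ((hF.continuous_fderiv one_ne_zero).clm_apply continuous_const)
  have hpos : 0 < σ * fderiv ℝ (nehariMap V f) (z, τ z) (0, 1) := by
    rw [hdF, htb, sub_self, zero_add, mul_left_comm]
    exact mul_pos ht0 htσ
  have hne : normSqV V z.1 - fibreDeriv volume (iteratedDeriv 2 f) (D12.fn z.1) (τ z) ≠ 0 :=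
    fun h => by simp [h] at htσ
  refine (contDiffAt_of_unique_zero hF (by rw [nehariMap_apply, htb, sub_self, mul_zero])
    (hasDerivAt_nehariMap hf z (τ z)) ?_ ?_).contDiffWithinAt
  · rw [htb, sub_self, zero_add]
    exact mul_ne_zero ht0.ne' hne
  · have e1 : ∀ᶠ w in 𝓝 (z, τ z), w.1 ∈ U := continuous_fst.continuousAt.eventually (hU.mem_nhds hz)
    have e2 : ∀ᶠ w in 𝓝 (z, τ z), 0 < w.2 := continuous_snd.continuousAt.eventually
      (lt_mem_nhds ht0)
    have e3 : ∀ᶠ w in 𝓝 (z, τ z), 0 < σ * fderiv ℝ (nehariMap V f) w (0, 1) :=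
      hcont.continuousAt.eventually (lt_mem_nhds hpos)
    filter_upwards [e1, e2, e3] with w h1 h2 h3 h4
    obtain ⟨y, t⟩ := w
    rw [nehariMap_apply, mul_eq_zero, or_iff_right h2.ne'] at h4
    rw [hdF, h4, zero_add, mul_left_comm] at h3
    exact huniq y h1 t h2 (sub_eq_zero.1 h4) (pos_of_mul_pos_right h3 h2.le)

end Rays

end NehariFiber

theorem mainTheorem6 (N : ℕ) [Fact (3 ≤ N)] (V : NehariFiber.RN N → ℝ) (f : ℝ → ℝ)
    (hV : MemLp V (ENNReal.ofReal ((N : ℝ) / 2)) volume)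
    (hVS : eLpNorm V (ENNReal.ofReal ((N : ℝ) / 2)) volume
      < ENNReal.ofReal (NehariFiber.sobolevConst N))
    (hf : NehariFiber.IsDoublePower N f) :
    ∃ t₀ T : NehariFiber.D12 N → ℝ,
      (∀ u : NehariFiber.D12 N, u ≠ 0 →
        {t : ℝ | 0 < t ∧ t • u ∈ NehariFiber.nehari V f 0} = {t₀ u} ∧
        {t : ℝ | 0 < t ∧ t • u ∈ NehariFiber.inflection V f} = {T u}) ∧
      ∃ δ : ℝ, 0 < δ ∧ ∃ t₁ t₂ : NehariFiber.D12 N → NehariFiber.LDual N → ℝ,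
        (∀ (u : NehariFiber.D12 N) (g : NehariFiber.LDual N), u ≠ 0 → ‖g‖ < δ →
          (NehariFiber.pairing g u < 0 →
            {t : ℝ | 0 < t ∧ t • u ∈ NehariFiber.nehari V f g} = {t₁ u g} ∧
            t₀ u < t₁ u g) ∧
          (NehariFiber.pairing g u = 0 →
            {t : ℝ | 0 < t ∧ t • u ∈ NehariFiber.nehari V f g} = {t₁ u g} ∧
            t₁ u g = t₀ u) ∧
          (0 < NehariFiber.pairing g u →
            {t : ℝ | 0 < t ∧ t • u ∈ NehariFiber.nehari V f g} = {t₁ u g, t₂ u g} ∧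
            t₂ u g < T u ∧ T u < t₁ u g ∧ t₁ u g < t₀ u)) ∧
        ContDiffOn ℝ 1 (fun z : NehariFiber.D12 N × NehariFiber.LDual N => t₁ z.1 z.2)
          {z | z.1 ≠ 0 ∧ ‖z.2‖ < δ} ∧
        ContDiffOn ℝ 1 (fun z : NehariFiber.D12 N × NehariFiber.LDual N => t₂ z.1 z.2)
          {z | z.1 ≠ 0 ∧ ‖z.2‖ < δ ∧ 0 < NehariFiber.pairing z.2 z.1} ∧
        ∀ u : NehariFiber.D12 N, u ≠ 0 →
          Tendsto (fun g : NehariFiber.LDual N => t₁ u g) (𝓝 0) (𝓝 (t₀ u)) := by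
  have hfib := fun (u : NehariFiber.D12 N) (hu : u ≠ 0) =>
    NehariFiber.isConcaveFibre hV hVS hf hu
  choose! T hT0 hTA hTu using fun (u : NehariFiber.D12 N) (hu : u ≠ 0) =>
    (hfib u hu).existsUnique_turningPoint
  obtain ⟨δ, hδ, hδu⟩ := NehariFiber.exists_pairing_lt_max hV hVS hf
  have hmax : ∀ (u : NehariFiber.D12 N) (g : NehariFiber.LDual N), u ≠ 0 → ‖g‖ < δ →
      NehariFiber.pairing g u < T u * NehariFiber.normSqV V u -
        NehariFiber.fibre volume (deriv f) (NehariFiber.D12.fn u) (T u) := fun u g hu hg => by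
    obtain ⟨t, ht, hlt⟩ := hδu u g hu hg
    exact hlt.trans_le ((hfib u hu).sub_le_max (hT0 u hu) (hTA u hu) ht.le)
  choose! t₁ h₁ h₁u using fun (u : NehariFiber.D12 N) (g : NehariFiber.LDual N) (hu : u ≠ 0)
    (hg : ‖g‖ < δ) => (hfib u hu).existsUnique_descending (hT0 u hu) (hTA u hu) (hmax u g hu hg)
  choose! t₂ h₂ h₂u using fun (u : NehariFiber.D12 N) (g : NehariFiber.LDual N) (hu : u ≠ 0)
    (hg : ‖g‖ < δ) (hb : 0 < NehariFiber.pairing g u) =>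
    (hfib u hu).existsUnique_ascending (hT0 u hu) (hTA u hu) hb (hmax u g hu hg)
  have hz : ‖(0 : NehariFiber.LDual N)‖ < δ := by rwa [norm_zero]
  have hp0 : ∀ u : NehariFiber.D12 N, NehariFiber.pairing 0 u = 0 := fun u => by
    have h := Lp.coeFn_zero ℝ (ENNReal.ofReal (NehariFiber.dualExp N))
      (volume : Measure (NehariFiber.RN N))
    refine integral_eq_zero_of_ae ?_
    filter_upwards [h] with x hx
    rw [hx]
    simp
  -- for a level `∫ g u ≤ 0` there is no solution on the ascending branch
  have hset : ∀ (u : NehariFiber.D12 N) (g : NehariFiber.LDual N), u ≠ 0 → ‖g‖ < δ →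
      NehariFiber.pairing g u ≤ 0 →
      {t : ℝ | 0 < t ∧ t • u ∈ NehariFiber.nehari V f g} = {t₁ u g} := fun u g hu hg hb => by
    ext t
    simp only [mem_ofPred_eq, mem_singleton_iff]
    constructor
    · rintro ⟨ht, hmem⟩
      rw [NehariFiber.smul_mem_nehari_iff hu g ht] at hmem
      have hne := NehariFiber.IsConcaveFibre.deriv_ne_of_level (hTu u hu) (hmax u g hu hg) ht hmem
      rcases lt_or_gt_of_ne hne with h | h
      · exact absurd ((hfib u hu).pos_of_deriv_lt (hT0 u hu) (hTA u hu) ht hmem h) hb.not_gt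
      · exact h₁u u g hu hg t ⟨ht, hmem, h⟩
    · rintro rfl
      have h := h₁ u g hu hg
      exact ⟨h.1, (NehariFiber.smul_mem_nehari_iff hu g h.1).2 h.2.1⟩
  have hset2 : ∀ (u : NehariFiber.D12 N) (g : NehariFiber.LDual N), u ≠ 0 → ‖g‖ < δ →
      0 < NehariFiber.pairing g u →
      {t : ℝ | 0 < t ∧ t • u ∈ NehariFiber.nehari V f g} = {t₁ u g, t₂ u g} :=
    fun u g hu hg hb => by
    ext t
    simp only [mem_ofPred_eq, mem_insert_iff, mem_singleton_iff]
    constructor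
    · rintro ⟨ht, hmem⟩
      rw [NehariFiber.smul_mem_nehari_iff hu g ht] at hmem
      have hne := NehariFiber.IsConcaveFibre.deriv_ne_of_level (hTu u hu) (hmax u g hu hg) ht hmem
      rcases lt_or_gt_of_ne hne with h | h
      · exact Or.inr (h₂u u g hu hg hb t ⟨ht, hmem, h⟩)
      · exact Or.inl (h₁u u g hu hg t ⟨ht, hmem, h⟩)
    · rintro (rfl | rfl)
      · have h := h₁ u g hu hg
        exact ⟨h.1, (NehariFiber.smul_mem_nehari_iff hu g h.1).2 h.2.1⟩
      · have h := h₂ u g hu hg hb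
        exact ⟨h.1, (NehariFiber.smul_mem_nehari_iff hu g h.1).2 h.2.1⟩
  -- on the descending branch a higher level is attained earlier
  have hcmp : ∀ (u : NehariFiber.D12 N) (g g' : NehariFiber.LDual N), u ≠ 0 → ‖g‖ < δ →
      ‖g'‖ < δ → NehariFiber.pairing g u < NehariFiber.pairing g' u → t₁ u g' < t₁ u g :=
    fun u g g' hu hg hg' hlt => by
    have h := h₁ u g hu hg
    have h' := h₁ u g' hu hg'
    refine ((hfib u hu).lt_iff_of_descending (hT0 u hu) (hTA u hu) h.1 h.2.2 h'.1 h'.2.2).1 ?_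
    rwa [h.2.1, h'.2.1]
  have hopen : IsOpen {z : NehariFiber.D12 N × NehariFiber.LDual N | z.1 ≠ 0 ∧ ‖z.2‖ < δ} :=
    (isOpen_ne.preimage continuous_fst).inter (isOpen_lt continuous_snd.norm continuous_const)
  have hsmooth : ContDiffOn ℝ 1
      (fun z : NehariFiber.D12 N × NehariFiber.LDual N => t₁ z.1 z.2)
      {z | z.1 ≠ 0 ∧ ‖z.2‖ < δ} := by
    refine NehariFiber.contDiffOn_branch hV hf hopen (-1) (fun z hz => ?_)
      fun z hz t ht htb hts => ?_
    · obtain ⟨k1, k2, k3⟩ := h₁ z.1 z.2 hz.1 hz.2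
      exact ⟨k1, k2, by linarith⟩
    · exact h₁u z.1 z.2 hz.1 hz.2 t ⟨ht, htb, by linarith⟩
  -- `t₀` is the descending branch for `g = 0`
  refine ⟨fun u => t₁ u 0, T, fun u hu => ⟨hset u 0 hu hz (hp0 u).le, ?_⟩, δ, hδ, t₁, t₂,
    fun u g hu hg => ⟨fun hb => ⟨hset u g hu hg hb.le, ?_⟩, fun hb => ⟨hset u g hu hg hb.le, ?_⟩,
      fun hb => ⟨hset2 u g hu hg hb, ?_, ?_, ?_⟩⟩, hsmooth, ?_, fun u hu => ?_⟩
  · ext t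
    simp only [mem_ofPred_eq, mem_singleton_iff]
    constructor
    · rintro ⟨ht, hmem⟩
      exact hTu u hu t ht ((NehariFiber.smul_mem_inflection_iff hu ht).1 hmem)
    · rintro rfl
      exact ⟨hT0 u hu, (NehariFiber.smul_mem_inflection_iff hu (hT0 u hu)).2 (hTA u hu)⟩
  · exact hcmp u g 0 hu hg hz (by rwa [hp0])
  · have h := h₁ u g hu hg
    exact h₁u u 0 hu hz _ ⟨h.1, by rw [h.2.1, hp0, hb], h.2.2⟩
  · have h := h₂ u g hu hg hb
    exact ((hfib u hu).deriv_lt_iff (hT0 u hu) (hTA u hu) h.1).1 h.2.2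
  · have h := h₁ u g hu hg
    exact ((hfib u hu).lt_deriv_iff (hT0 u hu) (hTA u hu) h.1).1 h.2.2
  · exact hcmp u 0 g hu hz hg (by rwa [hp0])
  · have hopen2 : IsOpen {z : NehariFiber.D12 N × NehariFiber.LDual N |
        z.1 ≠ 0 ∧ ‖z.2‖ < δ ∧ 0 < NehariFiber.pairing z.2 z.1} :=
      (isOpen_ne.preimage continuous_fst).inter ((isOpen_lt continuous_snd.norm
        continuous_const).inter (isOpen_lt continuous_const NehariFiber.continuous_pairing))
    refine NehariFiber.contDiffOn_branch hV hf hopen2 1 (fun z hz => ?_)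
      fun z hz t ht htb hts => ?_
    · obtain ⟨k1, k2, k3⟩ := h₂ z.1 z.2 hz.1 hz.2.1 hz.2.2
      exact ⟨k1, k2, by linarith⟩
    · exact h₂u z.1 z.2 hz.1 hz.2.1 hz.2.2 t ⟨ht, htb, by linarith⟩
  · have hmem : (u, (0 : NehariFiber.LDual N)) ∈
        {z : NehariFiber.D12 N × NehariFiber.LDual N | z.1 ≠ 0 ∧ ‖z.2‖ < δ} := ⟨hu, hz⟩
    have hc : ContinuousAt (fun z : NehariFiber.D12 N × NehariFiber.LDual N => t₁ z.1 z.2) (u, 0) :=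
      hsmooth.continuousOn.continuousAt (hopen.mem_nhds hmem)
    exact hc.tendsto.comp ((Continuous.prodMk_right u).tendsto (0 : NehariFiber.LDual N))
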